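/- There is an absolute constant $c>0$ such that the following holds. Let $\xi$ be a real sub-Gaussian random variable (that is, $\mathbb{P}[|\xi|>t]\le Ce^{-at^2}$ for all $t\ge 0$, with some constants $a,C>0$) which has a density with respect to Lebesgue measure bounded by $K$. Let $n\ge 1$ and let $G_n$ be a random real $n\times n$ matrix such that the entries of $n^{1/2}G_n$ are independent copies of $\xi$. Let $A\in\mathbb{R}^{n\times n}$ with $\|A\|\le 1$, let $\delta\in(0,1)$, let $K'\in\mathbb{R}$, and let $z\in\mathbb{C}$ with $|z|\le 3\delta K'+3$ and $\operatorname{Im}z\ne 0$. Put $M=A+\delta G_n-zI$. Then, for every real $\epsilon$, \[ \mathbb{P}\big[\|G_n\|\le K'\ \text{and}\ \sigma_n(M)\le\epsilon\big]\le c\,(1+\delta K')\,\frac{\max(K,K^2)\,n^3\epsilon^2}{\delta^2|\operatorname{Im}z|}. \] Here $\|\cdot\|$ is the $\ell^2\to\ell^2$ operator norm and $\sigma_n(M)$ is the smallest singular value of $M$. -/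

import Mathlib

/-!
Suppose that `M v` is small for a unit vector `v` with `n ‖v i‖² ≥ 1`, and let `u` be a unit
vector which annihilates all columns of `M` but the `i`-th. Then the `i`-th entry of `u M` is at
most `ε √n`, while given the other columns this entry is `δ / √n` times a sum `∑ j, y j • u j` of
independent terms, shifted by a constant.

After multiplication by a phase the real and imaginary parts `a`, `b` of `u` are orthogonal with
`‖b‖ ≤ ‖a‖`, so that the sum lies in a disc of radius `s` with probability at most
`O(K² s² / (‖a‖ ‖b‖))`. The matrix is real apart from the shift by `z`, so the imaginary part of
`u M` gives `|Im z| ‖a‖ ≤ ‖A + δ G - Re z‖ ‖b‖ + ε √n`, and `b` cannot be much smaller than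
`|Im z|`.

The disc estimate follows Esseen: smoothing by a Gaussian bounds the concentration of a sum by the
integral of the product of the characteristic functions. A coefficient vector without dominant
coordinates makes this product integrable by Hölder's inequality; otherwise one conditions on all
coordinates but the dominant ones, for which the density bound suffices.
-/

open MeasureTheory ProbabilityTheory
open scoped Matrix.Norms.L2Operator

/-- A real random variable is sub-Gaussian if its tails satisfy
`ℙ(|X| > t) ≤ C exp (-a t ^ 2)` for all `t ≥ 0`, with some constants `a, C > 0`. -/
def IsSubGaussian {Ω : Type*} [MeasurableSpace Ω] (X : Ω → ℝ) (P : Measure Ω) : Prop :=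
  ∃ a C : ℝ, 0 < a ∧ 0 < C ∧
    ∀ t : ℝ, 0 ≤ t → P.real {ω | t < |X ω|} ≤ C * Real.exp (-a * t ^ 2)

/-- The law of the real random variable `X` has a density with respect to Lebesgue measure
which is bounded by `K`. -/
def HasDensityBoundedBy {Ω : Type*} [MeasurableSpace Ω] (X : Ω → ℝ) (P : Measure Ω) (K : ℝ) :
    Prop :=
  AEMeasurable X P ∧ ∃ f : ℝ → ℝ, Measurable f ∧ (∀ x, 0 ≤ f x ∧ f x ≤ K) ∧
    P.map X = volume.withDensity (fun x => ENNReal.ofReal (f x))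

/-- The random matrix `G` is distributed as `Gₙ(ξ)`: the entries of `√n G` are independent
copies of `ξ`. -/
structure IsScaledIIDMatrix {Ω Ω' : Type*} [MeasurableSpace Ω] [MeasurableSpace Ω'] {n : ℕ}
    (G : Ω → Matrix (Fin n) (Fin n) ℝ) (P : Measure Ω) (ξ : Ω' → ℝ) (P' : Measure Ω') :
    Prop where
  indep : iIndepFun (fun (p : Fin n × Fin n) (ω : Ω) => √(n : ℝ) * G ω p.1 p.2) P
  copies : ∀ i j : Fin n, IdentDistrib (fun ω => √(n : ℝ) * G ω i j) ξ P P'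

/-- The least singular value `σₙ(M)` of a complex `n × n` matrix, `n ≥ 1`. Mathlib's singular
values are nonincreasing and indexed from `0`, so this is the one of index `n - 1`. -/
noncomputable def leastSingularValue {n : ℕ} (M : Matrix (Fin n) (Fin n) ℂ) : ℝ :=
  (Matrix.toEuclideanLin M).singularValues (n - 1)

section GaussianSmoothing

variable {V : Type*} [NormedAddCommGroup V] [InnerProductSpace ℝ V] [FiniteDimensional ℝ V]
  [MeasurableSpace V] [BorelSpace V]

lemma integral_exp_neg_mul_sq_norm_mul_charFun (ν : Measure V) [IsFiniteMeasure ν] {b : ℝ}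
    (hb : 0 < b) :
    ∫ t, (Real.exp (-b * ‖t‖ ^ 2) : ℂ) * charFun ν t
      = ((Real.pi / b) ^ (Module.finrank ℝ V / 2 : ℝ) *
          ∫ x, Real.exp (-‖x‖ ^ 2 / (4 * b)) ∂ν : ℝ) := by
  have hb' : 0 < (b : ℂ).re := hb
  have gaussian_mul_character (t x : V) : (Real.exp (-b * ‖t‖ ^ 2) : ℂ) *
      Complex.exp (inner ℝ x t * Complex.I)
        = Complex.exp (-b * ‖t‖ ^ 2 + Complex.I * inner ℝ x t) := by
    rw [Complex.exp_add, mul_comm Complex.I]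
    push_cast
    rfl
  have transform (x : V) : ∫ t : V, Complex.exp (-b * ‖t‖ ^ 2 + Complex.I * inner ℝ x t)
      = ((Real.pi / b) ^ (Module.finrank ℝ V / 2 : ℝ) * Real.exp (-‖x‖ ^ 2 / (4 * b)) : ℝ) := by
    rw [GaussianFourier.integral_cexp_neg_mul_sq_norm_add hb', Complex.I_sq]
    push_cast [Complex.ofReal_cpow (div_pos Real.pi_pos hb).le]
    ring_nf
  have integrable_gaussian : Integrable fun t : V => Real.exp (-b * ‖t‖ ^ 2) := by
    have := (GaussianFourier.integrable_cexp_neg_mul_sq_norm_add hb' 0 (0 : V)).norm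
    simpa [Complex.norm_exp, ← Complex.ofReal_pow] using this
  simp_rw [charFun_apply, ← integral_const_mul]
  rw [integral_integral_swap]
  · simp_rw [gaussian_mul_character, transform, integral_complex_ofReal]
  · refine (integrable_gaussian.comp_fst ν).mono' ?_ (ae_of_all _ fun p => ?_)
    · exact (by fun_prop : Continuous fun p : V × V => (Real.exp (-b * ‖p.1‖ ^ 2) : ℂ) *
        Complex.exp (inner ℝ p.2 p.1 * Complex.I)).aestronglyMeasurable
    · dsimp only [Function.uncurry]
      rw [norm_mul, Complex.norm_exp_ofReal_mul_I, mul_one,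
        Complex.norm_of_nonneg (Real.exp_pos _).le]

lemma measureReal_closedBall_zero_le_integral_exp (ν : Measure V) [IsFiniteMeasure ν] {s : ℝ}
    (hs : 0 < s) :
    Real.exp (-1 / 4) * ν.real (Metric.closedBall 0 s)
      ≤ ∫ x, Real.exp (-‖x‖ ^ 2 / (4 * s ^ 2)) ∂ν := by
  have integrable_exp : Integrable (fun x => Real.exp (-‖x‖ ^ 2 / (4 * s ^ 2))) ν := by
    refine .of_bound (C := 1) (by fun_prop) (ae_of_all _ fun x => ?_)
    rw [Real.norm_eq_abs, Real.abs_exp, Real.exp_le_one_iff, neg_div, neg_nonpos]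
    positivity
  refine le_trans ?_ (mul_meas_ge_le_integral_of_nonneg
    (ae_of_all _ fun x => (Real.exp_pos _).le) integrable_exp (Real.exp (-1 / 4)))
  refine mul_le_mul_of_nonneg_left (measureReal_mono fun x hx => ?_) (Real.exp_pos _).le
  have hx : ‖x‖ ≤ s := by simpa using hx
  simp only [Set.mem_ofPred_eq, Real.exp_le_exp]
  rw [div_le_div_iff₀ (by norm_num) (by positivity)]
  nlinarith [norm_nonneg x]

lemma measure_closedBall_zero_le_lintegral_charFun (ν : Measure V) [IsFiniteMeasure ν] {s : ℝ}
    (hs : 0 < s) :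
    ν (Metric.closedBall 0 s)
      ≤ ENNReal.ofReal (2 * s ^ Module.finrank ℝ V) * ∫⁻ t, ‖charFun ν t‖ₑ := by
  set d := Module.finrank ℝ V
  have smoothing := integral_exp_neg_mul_sq_norm_mul_charFun ν (sq_pos_of_pos hs)
  have upper : ENNReal.ofReal ((Real.pi / s ^ 2) ^ (d / 2 : ℝ) *
      ∫ x, Real.exp (-‖x‖ ^ 2 / (4 * s ^ 2)) ∂ν) ≤ ∫⁻ t, ‖charFun ν t‖ₑ := by
    rw [← Complex.norm_of_nonneg (r := _ * _) (by positivity), ofReal_norm, ← smoothing]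
    refine (enorm_integral_le_lintegral_enorm _).trans (lintegral_mono fun t => ?_)
    rw [enorm_mul]
    refine mul_le_of_le_one_left' ?_
    rw [← ofReal_norm, Complex.norm_of_nonneg (Real.exp_pos _).le, ENNReal.ofReal_le_one,
      Real.exp_le_one_iff, neg_mul, neg_nonpos]
    positivity
  have normalization : 1 ≤ 2 * s ^ d * ((Real.pi / s ^ 2) ^ (d / 2 : ℝ) * Real.exp (-1 / 4)) := by
    have : s ^ d * (Real.pi / s ^ 2) ^ (d / 2 : ℝ) = √Real.pi ^ d := by
      rw [Real.rpow_div_two_eq_sqrt _ (by positivity), Real.rpow_natCast, ← mul_pow,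
        Real.sqrt_div Real.pi_pos.le, Real.sqrt_sq hs.le, mul_div_cancel₀ _ hs.ne']
    have one_le : 1 ≤ √Real.pi ^ d :=
      one_le_pow₀ (Real.one_le_sqrt.mpr (by linarith [Real.pi_gt_three]))
    nlinarith [Real.add_one_le_exp (-1 / 4 : ℝ)]
  calc ν (Metric.closedBall 0 s) = ENNReal.ofReal (1 * ν.real (Metric.closedBall 0 s)) := by
        rw [one_mul, ofReal_measureReal]
    _ ≤ ENNReal.ofReal (2 * s ^ d * ((Real.pi / s ^ 2) ^ (d / 2 : ℝ) *
          ∫ x, Real.exp (-‖x‖ ^ 2 / (4 * s ^ 2)) ∂ν)) := by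
        refine ENNReal.ofReal_le_ofReal ?_
        calc 1 * ν.real (Metric.closedBall 0 s)
            ≤ 2 * s ^ d * ((Real.pi / s ^ 2) ^ (d / 2 : ℝ) * Real.exp (-1 / 4)) *
                ν.real (Metric.closedBall 0 s) := by gcongr
          _ = 2 * s ^ d * ((Real.pi / s ^ 2) ^ (d / 2 : ℝ) *
                (Real.exp (-1 / 4) * ν.real (Metric.closedBall 0 s))) := by ring
          _ ≤ _ := by
              gcongr
              exact measureReal_closedBall_zero_le_integral_exp ν hs
    _ ≤ ENNReal.ofReal (2 * s ^ d) * ∫⁻ t, ‖charFun ν t‖ₑ := by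
        rw [ENNReal.ofReal_mul (by positivity)]
        gcongr

lemma measure_closedBall_le_lintegral_charFun (ν : Measure V) [IsFiniteMeasure ν] (x : V)
    {s : ℝ} (hs : 0 < s) :
    ν (Metric.closedBall x s)
      ≤ ENNReal.ofReal (2 * s ^ Module.finrank ℝ V) * ∫⁻ t, ‖charFun ν t‖ₑ := by
  have translate := measure_closedBall_zero_le_lintegral_charFun (ν.map (· + -x)) hs
  rw [Measure.map_apply (by fun_prop) measurableSet_closedBall] at translate
  have enorm_charFun (t : V) : ‖charFun (ν.map (· + -x)) t‖ₑ = ‖charFun ν t‖ₑ := by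
    rw [charFun_map_add_const, ← ofReal_norm, norm_mul, Complex.norm_exp_ofReal_mul_I, mul_one,
      ofReal_norm]
  simpa [enorm_charFun] using translate

variable {ι : Type*} [Fintype ι] {μ : Measure ℝ} [IsProbabilityMeasure μ]

lemma charFun_map_sum_smul (v : ι → V) (t : V) :
    charFun ((Measure.pi fun _ : ι => μ).map fun g => ∑ j, g j • v j) t
      = ∏ j, charFun μ (inner ℝ (v j) t) := by
  simp_rw [charFun_apply_real]
  rw [charFun_apply, integral_map (by fun_prop : Measurable _).aemeasurable (by fun_prop),
    ← integral_fintype_prod_eq_prod (μ := fun _ => μ)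
    (fun j (x : ℝ) => Complex.exp (inner ℝ (v j) t * x * Complex.I))]
  congr 1 with g
  rw [← Complex.exp_sum, sum_inner, ← Finset.sum_mul]
  simp [real_inner_smul_left, mul_comm]

lemma measure_pi_norm_sum_smul_sub_le_lintegral_charFun (v : ι → V) (x : V) {s : ℝ} (hs : 0 < s) :
    (Measure.pi fun _ : ι => μ) {g | ‖∑ j, g j • v j - x‖ ≤ s}
      ≤ ENNReal.ofReal (2 * s ^ Module.finrank ℝ V) *
        ∫⁻ t, ∏ j, ‖charFun μ (inner ℝ (v j) t)‖ₑ := by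
  have esseen := measure_closedBall_le_lintegral_charFun
    ((Measure.pi fun _ : ι => μ).map fun g => ∑ j, g j • v j) x hs
  rw [Measure.map_apply (by fun_prop) measurableSet_closedBall] at esseen
  simp_rw [charFun_map_sum_smul] at esseen
  simpa [enorm_eq_nnnorm, nnnorm_prod, Set.preimage, dist_eq_norm] using esseen

end GaussianSmoothing

section CharFunSquareIntegral

/-- The law of the difference of two independent random variables of law `μ`. -/
noncomputable def symmetrization (μ : Measure ℝ) : Measure ℝ := μ ∗ μ.map ((-1 : ℝ) • ·)

variable {μ ν : Measure ℝ} {K : ℝ}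

instance [IsProbabilityMeasure μ] : IsProbabilityMeasure (symmetrization μ) :=
  have : IsProbabilityMeasure (μ.map ((-1 : ℝ) • ·)) :=
    Measure.isProbabilityMeasure_map (by fun_prop)
  inferInstanceAs (IsProbabilityMeasure (μ ∗ _))

lemma charFun_symmetrization [IsProbabilityMeasure μ] (t : ℝ) :
    charFun (symmetrization μ) t = (‖charFun μ t‖ ^ 2 : ℝ) := by
  have : IsProbabilityMeasure (μ.map ((-1 : ℝ) • ·)) :=
    Measure.isProbabilityMeasure_map (by fun_prop)
  rw [symmetrization, charFun_conv, charFun_map_smul, neg_one_smul, charFun_neg, Complex.mul_conj,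
    Complex.normSq_eq_norm_sq]

lemma conv_le_smul_volume [SFinite μ] [IsProbabilityMeasure ν] {c : ENNReal}
    (hμ : μ ≤ c • volume) : μ ∗ ν ≤ c • volume := by
  refine Measure.le_iff.mpr fun s hs => ?_
  rw [Measure.conv, Measure.map_apply (by fun_prop) hs,
    Measure.prod_apply_symm (measurable_add hs)]
  calc _ ≤ ∫⁻ _, (c • volume) s ∂ν := lintegral_mono fun y => by
        refine (hμ _).trans_eq ?_
        simp only [Measure.smul_apply]
        congr 1
        exact measure_preimage_add_right volume y s
    _ = (c • volume) s := by simp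

lemma symmetrization_le_smul_volume [IsProbabilityMeasure μ] {c : ENNReal}
    (hμ : μ ≤ c • volume) : symmetrization μ ≤ c • volume :=
  have : IsProbabilityMeasure (μ.map ((-1 : ℝ) • ·)) :=
    Measure.isProbabilityMeasure_map (by fun_prop)
  conv_le_smul_volume hμ

lemma pos_of_le_ofReal_smul_volume [NeZero μ] (hμ : μ ≤ ENNReal.ofReal K • volume) : 0 < K := by
  contrapose! hμ
  rw [ENNReal.ofReal_of_nonpos hμ, zero_smul]
  exact fun hle => NeZero.ne μ (le_antisymm hle (Measure.zero_le μ))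

lemma integral_exp_neg_sq_div_le [NeZero μ] (hμ : μ ≤ ENNReal.ofReal K • volume) {b : ℝ}
    (hb : 0 < b) : ∫ x, Real.exp (-x ^ 2 / (4 * b)) ∂μ ≤ K * √(4 * Real.pi * b) := by
  have hK := pos_of_le_ofReal_smul_volume hμ
  have gaussian_form (x : ℝ) : Real.exp (-x ^ 2 / (4 * b)) = Real.exp (-(4 * b)⁻¹ * x ^ 2) := by
    congr 1
    ring
  simp_rw [gaussian_form]
  calc ∫ x, Real.exp (-(4 * b)⁻¹ * x ^ 2) ∂μ
      ≤ ∫ x, Real.exp (-(4 * b)⁻¹ * x ^ 2) ∂(ENNReal.ofReal K • volume) :=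
        integral_mono_measure hμ (ae_of_all _ fun x => (Real.exp_pos _).le)
          ((integrable_exp_neg_mul_sq (by positivity)).smul_measure ENNReal.ofReal_ne_top)
    _ = K * √(4 * Real.pi * b) := by
        rw [integral_smul_measure, integral_gaussian, ENNReal.toReal_ofReal hK.le, smul_eq_mul,
          div_inv_eq_mul]
        ring_nf

variable [IsProbabilityMeasure μ]

lemma lintegral_exp_neg_mul_enorm_charFun_sq_le (hμ : μ ≤ ENNReal.ofReal K • volume) {b : ℝ}
    (hb : 0 < b) :
    ∫⁻ t, ENNReal.ofReal (Real.exp (-b * t ^ 2)) * ‖charFun μ t‖ₑ ^ 2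
      ≤ ENNReal.ofReal (2 * Real.pi * K) := by
  have smoothing : ∫ t, Real.exp (-b * t ^ 2) * ‖charFun μ t‖ ^ 2
      = √(Real.pi / b) * ∫ x, Real.exp (-x ^ 2 / (4 * b)) ∂(symmetrization μ) := by
    have := integral_exp_neg_mul_sq_norm_mul_charFun (symmetrization μ) hb
    simp_rw [charFun_symmetrization, ← Complex.ofReal_mul, integral_complex_ofReal] at this
    simpa [Real.sqrt_eq_rpow] using Complex.ofReal_injective this
  have measurable_charFun_sq : Measurable fun t => ‖charFun μ t‖ ^ 2 :=
    (measurable_charFun.norm).pow_const 2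
  have integrable_regularized : Integrable fun t => Real.exp (-b * t ^ 2) * ‖charFun μ t‖ ^ 2 :=
    (integrable_exp_neg_mul_sq hb).mul_bdd (c := 1) measurable_charFun_sq.aestronglyMeasurable
      (ae_of_all _ fun t => by simpa using norm_charFun_le_one (μ := μ) t)
  calc ∫⁻ t, ENNReal.ofReal (Real.exp (-b * t ^ 2)) * ‖charFun μ t‖ₑ ^ 2
      = ENNReal.ofReal (∫ t, Real.exp (-b * t ^ 2) * ‖charFun μ t‖ ^ 2) := by
        rw [ofReal_integral_eq_lintegral_ofReal integrable_regularized
          (ae_of_all _ fun t => by positivity)]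
        refine lintegral_congr fun t => ?_
        rw [ENNReal.ofReal_mul (Real.exp_pos _).le, ENNReal.ofReal_pow (norm_nonneg _), ofReal_norm]
    _ ≤ ENNReal.ofReal (√(Real.pi / b) * (K * √(4 * Real.pi * b))) := by
        rw [smoothing]
        gcongr
        exact integral_exp_neg_sq_div_le (symmetrization_le_smul_volume hμ) hb
    _ = ENNReal.ofReal (2 * Real.pi * K) := by
        congr 1
        rw [mul_left_comm, ← Real.sqrt_mul (by positivity), mul_comm,
          show Real.pi / b * (4 * Real.pi * b) = (2 * Real.pi) ^ 2 by field_simp; ring,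
          Real.sqrt_sq (by positivity)]

lemma lintegral_enorm_charFun_sq_le (hμ : μ ≤ ENNReal.ofReal K • volume) :
    ∫⁻ t, ‖charFun μ t‖ₑ ^ 2 ≤ ENNReal.ofReal (2 * Real.pi * K) := by
  have tendsto_regularized (t : ℝ) : Filter.Tendsto (fun n : ℕ =>
      ENNReal.ofReal (Real.exp (-(1 / ((n : ℝ) + 1)) * t ^ 2)) * ‖charFun μ t‖ₑ ^ 2) Filter.atTop
      (nhds (‖charFun μ t‖ₑ ^ 2)) := by
    have h := (tendsto_one_div_add_atTop_nhds_zero_nat (𝕜 := ℝ)).neg.mul_const (t ^ 2)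
    simpa using ENNReal.Tendsto.mul_const
      (ENNReal.tendsto_ofReal ((Real.continuous_exp.tendsto _).comp h)) (.inr (by simp))
  calc ∫⁻ t, ‖charFun μ t‖ₑ ^ 2
      = ∫⁻ t, Filter.liminf (fun n : ℕ => ENNReal.ofReal (Real.exp (-(1 / ((n : ℝ) + 1)) * t ^ 2)) *
          ‖charFun μ t‖ₑ ^ 2) Filter.atTop :=
        lintegral_congr fun t => (tendsto_regularized t).liminf_eq.symm
    _ ≤ Filter.liminf (fun n : ℕ => ∫⁻ t, ENNReal.ofReal (Real.exp (-(1 / ((n : ℝ) + 1)) * t ^ 2)) *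
          ‖charFun μ t‖ₑ ^ 2) Filter.atTop :=
        lintegral_liminf_le fun n => .mul (by fun_prop) (measurable_charFun.enorm.pow_const 2)
    _ ≤ ENNReal.ofReal (2 * Real.pi * K) :=
        Filter.liminf_le_of_frequently_le' <| .of_forall fun n =>
          lintegral_exp_neg_mul_enorm_charFun_sq_le hμ (by positivity)

end CharFunSquareIntegral

section CharFunPowerIntegral

lemma abs_sin_nat_mul_le (k : ℕ) (x : ℝ) : |Real.sin (k * x)| ≤ k * |Real.sin x| := by
  induction k with
  | zero => simp
  | succ k ih =>
    calc |Real.sin ((k + 1 : ℕ) * x)|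
        = |Real.sin (k * x) * Real.cos x + Real.cos (k * x) * Real.sin x| := by
          rw [← Real.sin_add]
          push_cast
          ring_nf
      _ ≤ |Real.sin (k * x)| * |Real.cos x| + |Real.cos (k * x)| * |Real.sin x| := by
          rw [← abs_mul, ← abs_mul]
          exact abs_add_le _ _
      _ ≤ k * |Real.sin x| * 1 + 1 * |Real.sin x| := by
          gcongr <;> exact Real.abs_cos_le_one _
      _ = (k + 1 : ℕ) * |Real.sin x| := by
          push_cast
          ring

lemma one_sub_cos_nat_mul_le (k : ℕ) (x : ℝ) :
    1 - Real.cos (k * x) ≤ k ^ 2 * (1 - Real.cos x) := by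
  have half_angle (y : ℝ) : 1 - Real.cos y = 2 * |Real.sin (y / 2)| ^ 2 := by
    rw [sq_abs, Real.sin_sq_eq_half_sub, mul_div_cancel₀ y two_ne_zero]
    ring
  calc 1 - Real.cos (k * x) = 2 * |Real.sin (k * (x / 2))| ^ 2 := by
        rw [half_angle, mul_div_assoc]
    _ ≤ 2 * (k * |Real.sin (x / 2)|) ^ 2 := by
        gcongr
        exact abs_sin_nat_mul_le k _
    _ = k ^ 2 * (1 - Real.cos x) := by
        rw [half_angle]
        ring

lemma one_sub_re_charFun_eq_integral_cos (ν : Measure ℝ) [IsProbabilityMeasure ν] (t : ℝ) :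
    1 - (charFun ν t).re = ∫ x, (1 - Real.cos (t * x)) ∂ν := by
  have integrable_character : Integrable (fun x : ℝ => Complex.exp (t * x * Complex.I)) ν := by
    refine .of_bound (C := 1) (by fun_prop) (ae_of_all _ fun x => ?_)
    rw [← Complex.ofReal_mul, Complex.norm_exp_ofReal_mul_I]
  have integrable_cos : Integrable (fun x => Real.cos (t * x)) ν :=
    .of_bound (C := 1) (by fun_prop) (ae_of_all _ fun x => Real.abs_cos_le_one _)
  rw [integral_sub (integrable_const 1) integrable_cos, charFun_apply_real,
    ← RCLike.re_eq_complex_re, ← integral_re integrable_character]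
  simp [← Complex.ofReal_mul, Complex.exp_ofReal_mul_I_re]

lemma one_sub_re_charFun_nat_mul_le (ν : Measure ℝ) [IsProbabilityMeasure ν] (k : ℕ) (t : ℝ) :
    1 - (charFun ν (k * t)).re ≤ k ^ 2 * (1 - (charFun ν t).re) := by
  have integrable_one_sub_cos (s : ℝ) : Integrable (fun x => 1 - Real.cos (s * x)) ν :=
    (integrable_const 1).sub <|
      .of_bound (C := 1) (by fun_prop) (ae_of_all _ fun x => Real.abs_cos_le_one _)
  rw [one_sub_re_charFun_eq_integral_cos, one_sub_re_charFun_eq_integral_cos,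
    ← integral_const_mul]
  refine integral_mono (integrable_one_sub_cos _) ((integrable_one_sub_cos _).const_mul _)
    fun x => ?_
  simpa only [mul_assoc] using one_sub_cos_nat_mul_le k (t * x)

variable {μ : Measure ℝ} [IsProbabilityMeasure μ] {K : ℝ}

lemma one_sub_norm_charFun_sq_nat_mul_le (k : ℕ) (t : ℝ) :
    1 - ‖charFun μ (k * t)‖ ^ 2 ≤ k ^ 2 * (1 - ‖charFun μ t‖ ^ 2) := by
  simpa only [charFun_symmetrization, Complex.ofReal_re]
    using one_sub_re_charFun_nat_mul_le (symmetrization μ) k t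

lemma volume_half_le_norm_charFun_sq_le (hμ : μ ≤ ENNReal.ofReal K • volume) :
    volume {t | 1 / 2 ≤ ‖charFun μ t‖ ^ 2} ≤ ENNReal.ofReal (4 * Real.pi * K) := by
  have markov := meas_ge_le_lintegral_div (μ := volume) (f := fun t => ‖charFun μ t‖ₑ ^ 2)
    (measurable_charFun.enorm.pow_const 2).aemeasurable (ε := ENNReal.ofReal (1 / 2))
    (by simp) ENNReal.ofReal_ne_top
  calc volume {t | 1 / 2 ≤ ‖charFun μ t‖ ^ 2}
      ≤ volume {t | ENNReal.ofReal (1 / 2) ≤ ‖charFun μ t‖ₑ ^ 2} := measure_mono fun t ht => by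
        rw [Set.mem_ofPred_eq, ← ofReal_norm, ← ENNReal.ofReal_pow (norm_nonneg _)]
        exact ENNReal.ofReal_le_ofReal ht
    _ ≤ ENNReal.ofReal (2 * Real.pi * K) / ENNReal.ofReal (1 / 2) := by
        refine markov.trans ?_
        gcongr
        exact lintegral_enorm_charFun_sq_le hμ
    _ = ENNReal.ofReal (4 * Real.pi * K) := by
        rw [← ENNReal.ofReal_div_of_pos (by norm_num)]
        ring_nf

lemma exists_nat_scaling_sublevel {x : ℝ} (hx : 0 < x) (hx2 : x ≤ 1 / 2) :
    ∃ k : ℕ, 0 < k ∧ k ^ 2 * x ≤ 1 / 2 ∧ (k : ℝ)⁻¹ ≤ 4 * √x := by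
  have hsqrt : 0 < √(2 * x) := by positivity
  have one_le : 1 ≤ 1 / √(2 * x) := by
    rw [le_div_iff₀ hsqrt, one_mul]
    exact Real.sqrt_le_one.mpr (by linarith)
  have floor_pos : 0 < ⌊1 / √(2 * x)⌋₊ := Nat.floor_pos.mpr one_le
  refine ⟨⌊1 / √(2 * x)⌋₊, floor_pos, ?_, ?_⟩
  · calc (⌊1 / √(2 * x)⌋₊ : ℝ) ^ 2 * x ≤ (1 / √(2 * x)) ^ 2 * x := by
          gcongr
          exact Nat.floor_le (by positivity)
      _ = 1 / 2 := by
          rw [div_pow, Real.sq_sqrt (by positivity)]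
          field_simp
  · have le_two_mul_floor : 1 / √(2 * x) ≤ 2 * ⌊1 / √(2 * x)⌋₊ := by
      have : (1 : ℝ) ≤ ⌊1 / √(2 * x)⌋₊ := by exact_mod_cast floor_pos
      linarith [Nat.lt_floor_add_one (1 / √(2 * x))]
    have sqrt_two_mul_le : √(2 * x) ≤ 2 * √x := by
      rw [Real.sqrt_mul (by norm_num)]
      gcongr
      exact Real.sqrt_le_left (by norm_num) |>.mpr (by norm_num)
    rw [div_le_iff₀ hsqrt] at le_two_mul_floor
    rw [inv_le_iff_one_le_mul₀ (by positivity)]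
    nlinarith [(Nat.cast_pos (α := ℝ)).mpr floor_pos]

/-- Multiplying `t` by `k` increases the defect `1 - |φ(t)|²` at most `k²` times, so the sublevel
set at `x` scaled by `1 / √x` still lies in the sublevel set at `1 / 2`. -/
lemma volume_one_sub_norm_charFun_sq_le (hμ : μ ≤ ENNReal.ofReal K • volume) {x : ℝ} (hx : 0 < x)
    (hx2 : x ≤ 1 / 2) :
    volume {t | 1 - ‖charFun μ t‖ ^ 2 ≤ x} ≤ ENNReal.ofReal (16 * Real.pi * K * √x) := by
  have := pos_of_le_ofReal_smul_volume hμ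
  obtain ⟨k, hk, k_sq_mul_le, inv_k_le⟩ := exists_nat_scaling_sublevel hx hx2
  calc volume {t | 1 - ‖charFun μ t‖ ^ 2 ≤ x}
      ≤ volume ((fun t => (k : ℝ) * t) ⁻¹' {t | 1 / 2 ≤ ‖charFun μ t‖ ^ 2}) := by
        refine measure_mono fun t (ht : 1 - ‖charFun μ t‖ ^ 2 ≤ x) => ?_
        have := one_sub_norm_charFun_sq_nat_mul_le (μ := μ) k t
        have : (k : ℝ) ^ 2 * (1 - ‖charFun μ t‖ ^ 2) ≤ k ^ 2 * x := by gcongr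
        change 1 / 2 ≤ ‖charFun μ (k * t)‖ ^ 2
        linarith
    _ = ENNReal.ofReal |(k : ℝ)⁻¹| * volume {t | 1 / 2 ≤ ‖charFun μ t‖ ^ 2} :=
        Real.volume_preimage_mul_left (by positivity) _
    _ ≤ ENNReal.ofReal (4 * √x) * ENNReal.ofReal (4 * Real.pi * K) := by
        rw [abs_of_nonneg (by positivity)]
        gcongr
        exact volume_half_le_norm_charFun_sq_le hμ
    _ = ENNReal.ofReal (16 * Real.pi * K * √x) := by
        rw [← ENNReal.ofReal_mul (by positivity)]
        ring_nf

end CharFunPowerIntegral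

section CharFunRpowIntegral

lemma lintegral_Ioi_exp_neg_mul {l : ℝ} (hl : 0 < l) (c : ℝ) :
    ∫⁻ x in Set.Ioi c, ENNReal.ofReal (l * Real.exp (-l * x))
      = ENNReal.ofReal (Real.exp (-l * c)) := by
  rw [← ofReal_integral_eq_lintegral_ofReal
    ((integrableOn_exp_mul_Ioi (neg_neg_of_pos hl) c).const_mul l)
    (ae_of_all _ fun x => by positivity), integral_const_mul,
    integral_exp_mul_Ioi (neg_neg_of_pos hl)]
  congr 1
  field_simp

lemma lintegral_Ioi_sqrt_mul_exp_neg_mul_le {l : ℝ} (hl : 0 < l) :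
    ∫⁻ x in Set.Ioi (0 : ℝ), ENNReal.ofReal (l * Real.exp (-l * x)) * ENNReal.ofReal √x
      ≤ ENNReal.ofReal (√l)⁻¹ := by
  have integrable_sqrt_mul_exp : IntegrableOn (fun x => x ^ (1 / 2 : ℝ) * Real.exp (-l * x))
      (Set.Ioi (0 : ℝ)) := by
    simpa using integrableOn_rpow_mul_exp_neg_mul_rpow (s := 1 / 2) (p := 1) (by norm_num)
      one_pos hl
  have Gamma_three_half_le_one : Real.Gamma (1 / 2 + 1) ≤ 1 := by
    rw [Real.Gamma_add_one (by norm_num), Real.Gamma_one_half_eq]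
    have : √Real.pi ≤ 2 := Real.sqrt_le_left (by norm_num) |>.mpr (by linarith [Real.pi_lt_four])
    linarith
  calc ∫⁻ x in Set.Ioi (0 : ℝ), ENNReal.ofReal (l * Real.exp (-l * x)) * ENNReal.ofReal √x
      = ENNReal.ofReal (∫ x in Set.Ioi (0 : ℝ), l * (x ^ (1 / 2 : ℝ) * Real.exp (-l * x))) := by
        rw [ofReal_integral_eq_lintegral_ofReal (integrable_sqrt_mul_exp.const_mul l)]
        · refine lintegral_congr fun x => ?_
          rw [← ENNReal.ofReal_mul (by positivity), Real.sqrt_eq_rpow]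
          ring_nf
        · filter_upwards [self_mem_ae_restrict measurableSet_Ioi] with x hx
          have : 0 < x := hx
          positivity
    _ ≤ ENNReal.ofReal (√l)⁻¹ := by
        refine ENNReal.ofReal_le_ofReal ?_
        have := integral_rpow_mul_exp_neg_mul_rpow (p := 1) (q := 1 / 2) one_pos (by norm_num) hl
        simp only [Real.rpow_one, div_one, mul_one] at this
        rw [integral_const_mul, this, ← mul_assoc]
        calc l * l ^ (-(1 / 2 + 1) : ℝ) * Real.Gamma (1 / 2 + 1)
            ≤ l * l ^ (-(1 / 2 + 1) : ℝ) * 1 := by gcongr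
          _ = (√l)⁻¹ := by
              rw [mul_one, Real.sqrt_eq_rpow, ← Real.rpow_neg hl.le, ← Real.rpow_one_add' hl.le]
              <;> norm_num

/-- Layer-cake: `exp (-l * D) = ∫ x in Ioi D, l * exp (-l * x)`. -/
lemma lintegral_exp_neg_mul_eq_lintegral_measure_lt {α : Type*} [MeasurableSpace α]
    {ν : Measure α} [SFinite ν] {D : α → ℝ} (hD : Measurable D) (hD0 : ∀ t, 0 ≤ D t) {l : ℝ}
    (hl : 0 < l) :
    ∫⁻ t, ENNReal.ofReal (Real.exp (-l * D t)) ∂ν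
      = ∫⁻ x in Set.Ioi (0 : ℝ), ENNReal.ofReal (l * Real.exp (-l * x)) * ν {t | D t < x} := by
  set weight : ℝ → ENNReal := fun x => ENNReal.ofReal (l * Real.exp (-l * x))
  have measurable_weight : Measurable weight := by fun_prop
  have measurable_layers : Measurable fun p : α × ℝ =>
      {p : α × ℝ | D p.1 < p.2}.indicator (fun p => weight p.2) p :=
    (measurable_weight.comp measurable_snd).indicator
      (measurableSet_lt (hD.comp measurable_fst) measurable_snd)
  calc ∫⁻ t, ENNReal.ofReal (Real.exp (-l * D t)) ∂ν
      = ∫⁻ t, (∫⁻ x in Set.Ioi (0 : ℝ), (Set.Ioi (D t)).indicator weight x) ∂ν := by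
        refine lintegral_congr fun t => ?_
        rw [← lintegral_Ioi_exp_neg_mul hl, setLIntegral_indicator measurableSet_Ioi,
          Set.inter_eq_left.mpr (Set.Ioi_subset_Ioi (hD0 t))]
    _ = ∫⁻ x in Set.Ioi (0 : ℝ), (∫⁻ t, (Set.Ioi (D t)).indicator weight x ∂ν) :=
        lintegral_lintegral_swap measurable_layers.aemeasurable
    _ = ∫⁻ x in Set.Ioi (0 : ℝ), weight x * ν {t | D t < x} := by
        refine lintegral_congr fun x => ?_
        rw [← lintegral_indicator_const (measurableSet_lt hD measurable_const)]
        rfl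

lemma setLIntegral_exp_neg_mul_le_of_measure_sublevel_le {α : Type*} [MeasurableSpace α]
    {ν : Measure α} [SFinite ν] {D : α → ℝ} (hD : Measurable D) (hD0 : ∀ t, 0 ≤ D t) {V h l : ℝ}
    (hh : 0 < h) (hl : 0 < l)
    (hsub : ∀ x, 0 < x → x ≤ h → ν {t | D t ≤ x} ≤ ENNReal.ofReal (V * √x)) :
    ∫⁻ t in {t | D t ≤ h}, ENNReal.ofReal (Real.exp (-l * D t)) ∂ν
      ≤ ENNReal.ofReal (V / √l) := by
  have measure_layer_le (x : ℝ) (hx : 0 < x) :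
      ν.restrict {t | D t ≤ h} {t | D t < x} ≤ ENNReal.ofReal V * ENNReal.ofReal √x := by
    rw [Measure.restrict_apply (measurableSet_lt hD measurable_const),
      ← ENNReal.ofReal_mul' (by positivity)]
    rcases le_total x h with hxh | hxh
    · exact (measure_mono fun t ht => le_of_lt (show D t < x from ht.1)).trans (hsub x hx hxh)
    · refine (measure_mono Set.inter_subset_right).trans ((hsub h hh le_rfl).trans ?_)
      rw [ENNReal.ofReal_mul' (by positivity), ENNReal.ofReal_mul' (by positivity)]
      gcongr
  calc ∫⁻ t in {t | D t ≤ h}, ENNReal.ofReal (Real.exp (-l * D t)) ∂ν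
      = ∫⁻ x in Set.Ioi (0 : ℝ), ENNReal.ofReal (l * Real.exp (-l * x)) *
          ν.restrict {t | D t ≤ h} {t | D t < x} :=
        lintegral_exp_neg_mul_eq_lintegral_measure_lt hD hD0 hl
    _ ≤ ∫⁻ x in Set.Ioi (0 : ℝ), ENNReal.ofReal V *
          (ENNReal.ofReal (l * Real.exp (-l * x)) * ENNReal.ofReal √x) := by
        refine setLIntegral_mono (by fun_prop) fun x hx => ?_
        rw [mul_left_comm]
        gcongr
        exact measure_layer_le x hx
    _ ≤ ENNReal.ofReal (V / √l) := by
        rw [lintegral_const_mul _ (by fun_prop), div_eq_mul_inv,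
          ENNReal.ofReal_mul' (by positivity)]
        gcongr
        exact lintegral_Ioi_sqrt_mul_exp_neg_mul_le hl

lemma rpow_le_exp_neg_half_mul_one_sub_sq {c p : ℝ} (hc : 0 ≤ c) (hp : 0 ≤ p) :
    c ^ p ≤ Real.exp (-(p / 2) * (1 - c ^ 2)) := by
  calc c ^ p = (c ^ 2) ^ (p / 2) := by
        rw [← Real.rpow_natCast_mul hc]
        congr 1
        push_cast
        ring
    _ ≤ Real.exp (-(1 - c ^ 2)) ^ (p / 2) := by
        gcongr
        linarith [Real.add_one_le_exp (-(1 - c ^ 2))]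
    _ = Real.exp (-(p / 2) * (1 - c ^ 2)) := by
        rw [← Real.exp_mul]
        ring_nf

lemma rpow_le_two_div_sqrt_mul_sq {c p : ℝ} (hc : 0 ≤ c) (hc2 : c ^ 2 ≤ 1 / 2) (hp : 2 ≤ p) :
    c ^ p ≤ 2 / √p * c ^ 2 := by
  have sqrt_le_two_rpow : √p ≤ 2 ^ (p / 2) := by
    have bernoulli := one_add_mul_self_le_rpow_one_add (s := 1) (by norm_num)
      (one_le_two.trans hp)
    calc √p ≤ √(2 ^ p) := Real.sqrt_le_sqrt (by norm_num at bernoulli; linarith)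
      _ = 2 ^ (p / 2) := by
          rw [Real.sqrt_eq_rpow, ← Real.rpow_mul zero_le_two]
          ring_nf
  calc c ^ p = (c ^ 2) ^ (p / 2 - 1) * c ^ 2 := by
        rw [← Real.rpow_natCast_mul hc, ← Real.rpow_natCast, ← Real.rpow_add_of_nonneg hc]
        · congr 1
          push_cast
          ring
        · push_cast
          linarith
        · positivity
    _ ≤ (1 / 2) ^ (p / 2 - 1) * c ^ 2 := by
        gcongr
        linarith
    _ = 2 / 2 ^ (p / 2) * c ^ 2 := by
        rw [one_div, Real.inv_rpow zero_le_two, Real.rpow_sub_one two_ne_zero, inv_div]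
    _ ≤ 2 / √p * c ^ 2 := by gcongr

variable {μ : Measure ℝ}

lemma enorm_charFun_rpow {p : ℝ} (hp : 0 ≤ p) (t : ℝ) :
    ‖charFun μ t‖ₑ ^ p = ENNReal.ofReal (‖charFun μ t‖ ^ p) := by
  rw [← ofReal_norm, ENNReal.ofReal_rpow_of_nonneg (norm_nonneg _) hp]

variable [IsProbabilityMeasure μ] {K : ℝ}

lemma measurable_one_sub_norm_charFun_sq : Measurable fun t => 1 - ‖charFun μ t‖ ^ 2 := by
  have := measurable_charFun (μ := μ)
  fun_prop

lemma setLIntegral_enorm_charFun_rpow_near_le (hμ : μ ≤ ENNReal.ofReal K • volume) {p : ℝ}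
    (hp : 0 < p) :
    ∫⁻ t in {t | 1 - ‖charFun μ t‖ ^ 2 ≤ 1 / 2}, ‖charFun μ t‖ₑ ^ p
      ≤ ENNReal.ofReal (16 * Real.pi * K / √(p / 2)) := by
  have defect_nonneg (t : ℝ) : 0 ≤ 1 - ‖charFun μ t‖ ^ 2 :=
    sub_nonneg.mpr (pow_le_one₀ (norm_nonneg _) (norm_charFun_le_one t))
  refine le_trans (lintegral_mono fun t => ?_)
    (setLIntegral_exp_neg_mul_le_of_measure_sublevel_le measurable_one_sub_norm_charFun_sq
      defect_nonneg one_half_pos (half_pos hp)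
      fun x hx hx2 => volume_one_sub_norm_charFun_sq_le hμ hx hx2)
  rw [enorm_charFun_rpow hp.le]
  exact ENNReal.ofReal_le_ofReal (rpow_le_exp_neg_half_mul_one_sub_sq (norm_nonneg _) hp.le)

lemma setLIntegral_enorm_charFun_rpow_far_le (hμ : μ ≤ ENNReal.ofReal K • volume) {p : ℝ}
    (hp : 2 ≤ p) :
    ∫⁻ t in {t | 1 - ‖charFun μ t‖ ^ 2 ≤ 1 / 2}ᶜ, ‖charFun μ t‖ₑ ^ p
      ≤ ENNReal.ofReal (4 * Real.pi * K / √p) := by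
  calc ∫⁻ t in {t | 1 - ‖charFun μ t‖ ^ 2 ≤ 1 / 2}ᶜ, ‖charFun μ t‖ₑ ^ p
      ≤ ∫⁻ t in {t | 1 - ‖charFun μ t‖ ^ 2 ≤ 1 / 2}ᶜ,
          ENNReal.ofReal (2 / √p) * ‖charFun μ t‖ₑ ^ 2 := by
        refine setLIntegral_mono'
          (measurableSet_le measurable_one_sub_norm_charFun_sq measurable_const).compl
          fun t (ht : ¬1 - ‖charFun μ t‖ ^ 2 ≤ 1 / 2) => ?_
        rw [enorm_charFun_rpow (by positivity), ← ofReal_norm,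
          ← ENNReal.ofReal_pow (norm_nonneg _), ← ENNReal.ofReal_mul (by positivity)]
        exact ENNReal.ofReal_le_ofReal
          (rpow_le_two_div_sqrt_mul_sq (norm_nonneg _) (by linarith) hp)
    _ ≤ ENNReal.ofReal (2 / √p) * ∫⁻ t, ‖charFun μ t‖ₑ ^ 2 := by
        rw [lintegral_const_mul _ (measurable_charFun.enorm.pow_const 2)]
        gcongr
        exact Measure.restrict_le_self
    _ ≤ ENNReal.ofReal (2 / √p) * ENNReal.ofReal (2 * Real.pi * K) := by
        gcongr
        exact lintegral_enorm_charFun_sq_le hμ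
    _ = ENNReal.ofReal (4 * Real.pi * K / √p) := by
        rw [← ENNReal.ofReal_mul (by positivity)]
        ring_nf

lemma lintegral_enorm_charFun_rpow_le (hμ : μ ≤ ENNReal.ofReal K • volume) {p : ℝ}
    (hp : 2 ≤ p) :
    ∫⁻ t, ‖charFun μ t‖ₑ ^ p ≤ ENNReal.ofReal (100 * K / √p) := by
  have hK := pos_of_le_ofReal_smul_volume hμ
  have sqrt_half_ge : √p * (2 / 3) ≤ √(p / 2) := by
    refine Real.le_sqrt_of_sq_le ?_
    rw [mul_pow, Real.sq_sqrt (by positivity)]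
    linarith
  rw [← lintegral_add_compl _
    (measurableSet_le measurable_one_sub_norm_charFun_sq (measurable_const (a := (1 / 2 : ℝ))) :
      MeasurableSet {t | 1 - ‖charFun μ t‖ ^ 2 ≤ 1 / 2})]
  refine (add_le_add (setLIntegral_enorm_charFun_rpow_near_le hμ (by positivity))
    (setLIntegral_enorm_charFun_rpow_far_le hμ hp)).trans ?_
  rw [← ENNReal.ofReal_add (by positivity) (by positivity)]
  refine ENNReal.ofReal_le_ofReal ?_
  calc 16 * Real.pi * K / √(p / 2) + 4 * Real.pi * K / √p
      ≤ 16 * Real.pi * K / (√p * (2 / 3)) + 4 * Real.pi * K / √p := by gcongr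
    _ = 28 * Real.pi * K / √p := by
        field_simp
        ring
    _ ≤ 100 * K / √p := by
        gcongr
        linarith [Real.pi_lt_d2]

lemma lintegral_enorm_charFun_rpow_inv_le (hμ : μ ≤ ENNReal.ofReal K • volume) {r : ℝ}
    (hr : 0 < r) (hr2 : r ≤ 1 / 2) :
    ∫⁻ t, ‖charFun μ t‖ₑ ^ r⁻¹ ≤ ENNReal.ofReal (100 * K) * ENNReal.ofReal √r := by
  refine (lintegral_enorm_charFun_rpow_le hμ ?_).trans_eq ?_
  · rw [le_inv_comm₀ two_pos hr]
    linarith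
  · rw [← ENNReal.ofReal_mul' (by positivity), Real.sqrt_inv, div_inv_eq_mul]

end CharFunRpowIntegral

section LinearChangeOfVariables

lemma lintegral_comp_const_mul {f : ℝ → ENNReal} (hf : Measurable f) {a : ℝ} (ha : a ≠ 0) :
    ∫⁻ t, f (a * t) = ENNReal.ofReal |a⁻¹| * ∫⁻ t, f t := by
  rw [← smul_eq_mul, ← lintegral_smul_measure, ← Real.map_volume_mul_left ha,
    lintegral_map hf (by fun_prop)]

lemma lintegral_comp_linear_prod {F : ℝ × ℝ → ENNReal} (hF : Measurable F) {a b c d : ℝ}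
    (hdet : a * d - b * c ≠ 0) :
    ∫⁻ θ : ℝ × ℝ, F (a * θ.1 + b * θ.2, c * θ.1 + d * θ.2)
      = ENNReal.ofReal |(a * d - b * c)⁻¹| * ∫⁻ θ, F θ := by
  set f := Matrix.toLin (Module.Basis.finTwoProd ℝ) (Module.Basis.finTwoProd ℝ) !![a, b; c, d]
    with f_def
  have det_f : LinearMap.det f = a * d - b * c := by
    rw [f_def, LinearMap.det_toLin, Matrix.det_fin_two_of]
  have measurable_f : Measurable f := (LinearMap.continuous_of_finiteDimensional f).measurable
  have map_f := Measure.map_linearMap_addHaar_eq_smul_addHaar volume (det_f ▸ hdet)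
  rw [← det_f, ← smul_eq_mul, ← lintegral_smul_measure, ← map_f, lintegral_map hF measurable_f]
  refine lintegral_congr fun θ => ?_
  rw [f_def, Matrix.toLin_finTwoProd_apply]

end LinearChangeOfVariables

section HolderLinearForms

lemma prod_rpow_eq_rpow_sum {κ : Type*} (s : Finset κ) (x : ENNReal) {w : κ → ℝ}
    (hw : ∀ i, 0 ≤ w i) : ∏ i ∈ s, x ^ w i = x ^ ∑ i ∈ s, w i := by
  induction s using Finset.cons_induction with
  | empty => simp
  | cons i s hi ih =>
    rw [Finset.prod_cons, Finset.sum_cons, ih,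
      ENNReal.rpow_add_of_nonneg _ _ (hw i) (Finset.sum_nonneg fun j _ => hw j)]

variable {ι : Type*} [Fintype ι] {Ψ : ℝ → ENNReal} {B : ENNReal} {a b : ι → ℝ}

lemma lintegral_prod_comp_mul_le (hΨ : Measurable Ψ) (hΨ0 : Ψ 0 = 1)
    (hB : ∀ r : ℝ, 0 < r → r ≤ 1 / 2 → ∫⁻ t, Ψ t ^ r⁻¹ ≤ B * ENNReal.ofReal √r)
    (ha : ∑ j, a j ^ 2 = 1) (ha_half : ∀ j, a j ^ 2 ≤ 1 / 2) :
    ∫⁻ t, ∏ j, Ψ (a j * t) ≤ B := by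
  have factor_le (j : ι) (hj : a j ≠ 0) : ∫⁻ t, Ψ (a j * t) ^ (a j ^ 2)⁻¹ ≤ B := by
    rw [lintegral_comp_const_mul (hΨ.pow_const _) hj]
    calc ENNReal.ofReal |(a j)⁻¹| * ∫⁻ t, Ψ t ^ (a j ^ 2)⁻¹
        ≤ ENNReal.ofReal |(a j)⁻¹| * (B * ENNReal.ofReal √(a j ^ 2)) := by
          gcongr
          exact hB _ (by positivity) (ha_half j)
      _ = B := by
          rw [mul_left_comm, ← ENNReal.ofReal_mul (abs_nonneg _), Real.sqrt_sq_eq_abs, abs_inv,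
            inv_mul_cancel₀ (abs_ne_zero.mpr hj), ENNReal.ofReal_one, mul_one]
  calc ∫⁻ t, ∏ j, Ψ (a j * t)
      = ∫⁻ t, ∏ j, (Ψ (a j * t) ^ (a j ^ 2)⁻¹) ^ a j ^ 2 := by
        refine lintegral_congr fun t => Finset.prod_congr rfl fun j _ => ?_
        by_cases hj : a j = 0
        · simp [hj, hΨ0]
        · rw [ENNReal.rpow_inv_rpow (by positivity)]
    _ ≤ ∏ j, (∫⁻ t, Ψ (a j * t) ^ (a j ^ 2)⁻¹) ^ a j ^ 2 :=
        ENNReal.lintegral_prod_norm_pow_le _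
          (fun j _ => ((hΨ.comp (measurable_const_mul _)).pow_const _).aemeasurable) ha
          fun j _ => sq_nonneg _
    _ ≤ ∏ j, B ^ a j ^ 2 := by
        refine Finset.prod_le_prod' fun j _ => ?_
        by_cases hj : a j = 0
        · simp [hj]
        · gcongr
          exact factor_le j hj
    _ = B := by
        rw [prod_rpow_eq_rpow_sum _ _ fun j => sq_nonneg _, ha, ENNReal.rpow_one]

lemma sum_cross_sq {p q : ℝ} (ha : ∑ j, a j ^ 2 = p) (hb : ∑ j, b j ^ 2 = q)
    (hab : ∑ j, a j * b j = 0) (x y : ℝ) :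
    ∑ k, (x * b k - y * a k) ^ 2 = x ^ 2 * q + y ^ 2 * p := by
  have expand (k : ι) : (x * b k - y * a k) ^ 2
      = x ^ 2 * b k ^ 2 - 2 * x * y * (a k * b k) + y ^ 2 * a k ^ 2 := by ring
  simp_rw [expand, Finset.sum_add_distrib, Finset.sum_sub_distrib, ← Finset.mul_sum, ha, hb, hab]
  ring

lemma sqrt_le_exp_half {y : ℝ} (hy : 0 ≤ y) : √y ≤ Real.exp (y / 2) := by
  nlinarith [Real.add_one_le_exp (y / 2), Real.sq_sqrt hy, sq_nonneg (√y - 1)]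

lemma inv_abs_mul_sqrt_mul_sqrt_rpow_le_exp {r r' D : ℝ} (hr : 0 ≤ r) (hr' : 0 ≤ r')
    (hD : D ≠ 0) :
    (|D⁻¹| * (√r * √r')) ^ (D ^ 2 / 2) ≤ Real.exp (r * r' / 4) := by
  calc (|D⁻¹| * (√r * √r')) ^ (D ^ 2 / 2)
      = √(r * r' / D ^ 2) ^ (D ^ 2 / 2) := by
        rw [Real.sqrt_div (by positivity), Real.sqrt_mul hr, Real.sqrt_sq_eq_abs, abs_inv,
          div_eq_inv_mul (√r * √r')]
    _ ≤ Real.exp (r * r' / D ^ 2 / 2) ^ (D ^ 2 / 2) := by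
        gcongr
        exact sqrt_le_exp_half (by positivity)
    _ = Real.exp (r * r' / 4) := by
        rw [← Real.exp_mul]
        congr 1
        field_simp
        norm_num

lemma lintegral_pair_rpow_le (hΨ : Measurable Ψ)
    (hB : ∀ r : ℝ, 0 < r → r ≤ 1 / 2 → ∫⁻ t, Ψ t ^ r⁻¹ ≤ B * ENNReal.ofReal √r)
    {x y x' y' : ℝ} (h : x ^ 2 + y ^ 2 ≤ 1 / 2) (h' : x' ^ 2 + y' ^ 2 ≤ 1 / 2) :
    (∫⁻ θ : ℝ × ℝ, Ψ (x * θ.1 + y * θ.2) ^ (x ^ 2 + y ^ 2)⁻¹ *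
        Ψ (x' * θ.1 + y' * θ.2) ^ (x' ^ 2 + y' ^ 2)⁻¹) ^ ((x * y' - y * x') ^ 2 / 2)
      ≤ (B ^ 2) ^ ((x * y' - y * x') ^ 2 / 2) *
        ENNReal.ofReal (Real.exp ((x ^ 2 + y ^ 2) * (x' ^ 2 + y' ^ 2) / 4)) := by
  set r := x ^ 2 + y ^ 2 with r_def
  set r' := x' ^ 2 + y' ^ 2 with r'_def
  set D := x * y' - y * x' with D_def
  have r_nonneg : 0 ≤ r := by positivity
  have r'_nonneg : 0 ≤ r' := by positivity
  by_cases hD : D = 0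
  · simpa [hD] using div_nonneg (mul_nonneg r_nonneg r'_nonneg) zero_le_four
  have prod_pos : 0 < r * r' := by
    have lagrange : r * r' = D ^ 2 + (x * x' + y * y') ^ 2 := by
      rw [r_def, r'_def, D_def]
      ring
    rw [lagrange]
    positivity
  have r_pos : 0 < r := pos_of_mul_pos_left prod_pos r'_nonneg
  have r'_pos : 0 < r' := pos_of_mul_pos_right prod_pos r_nonneg
  calc (∫⁻ θ : ℝ × ℝ, Ψ (x * θ.1 + y * θ.2) ^ r⁻¹ * Ψ (x' * θ.1 + y' * θ.2) ^ r'⁻¹) ^ (D ^ 2 / 2)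
      = (ENNReal.ofReal |D⁻¹| * ((∫⁻ t, Ψ t ^ r⁻¹) * ∫⁻ t, Ψ t ^ r'⁻¹)) ^ (D ^ 2 / 2) := by
        rw [lintegral_comp_linear_prod (F := fun η => Ψ η.1 ^ r⁻¹ * Ψ η.2 ^ r'⁻¹)
          (by fun_prop) hD, Measure.volume_eq_prod, lintegral_prod_mul
          (hΨ.pow_const _).aemeasurable (hΨ.pow_const _).aemeasurable]
    _ ≤ (ENNReal.ofReal |D⁻¹| * (B * ENNReal.ofReal √r * (B * ENNReal.ofReal √r')))
          ^ (D ^ 2 / 2) := by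
        gcongr
        · exact hB r r_pos h
        · exact hB r' r'_pos h'
    _ = (B ^ 2 * ENNReal.ofReal (|D⁻¹| * (√r * √r'))) ^ (D ^ 2 / 2) := by
        rw [ENNReal.ofReal_mul (by positivity), ENNReal.ofReal_mul (by positivity)]
        ring_nf
    _ ≤ (B ^ 2) ^ (D ^ 2 / 2) * ENNReal.ofReal (Real.exp (r * r' / 4)) := by
        rw [ENNReal.mul_rpow_of_nonneg _ _ (by positivity),
          ENNReal.ofReal_rpow_of_nonneg (by positivity) (by positivity)]
        gcongr
        exact inv_abs_mul_sqrt_mul_sqrt_rpow_le_exp r_nonneg r'_nonneg hD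

lemma prod_eq_prod_pair_rpow {x : ι → ENNReal} {r : ι → ℝ} {w : ι → ι → ℝ}
    (hx : ∀ j, r j = 0 → x j = 1) (hw : ∀ j k, 0 ≤ w j k) (hw_symm : ∀ j k, w j k = w k j)
    (hw_sum : ∀ j, ∑ k, w j k = r j / 2) :
    ∏ j, x j = ∏ p : ι × ι, (x p.1 ^ (r p.1)⁻¹ * x p.2 ^ (r p.2)⁻¹) ^ w p.1 p.2 := by
  have rpow_half (j : ι) : (x j ^ (r j)⁻¹) ^ (r j / 2) = x j ^ (1 / 2 : ℝ) := by
    by_cases hj : r j = 0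
    · simp [hx j hj]
    · rw [← ENNReal.rpow_mul]
      congr 1
      field_simp
  simp_rw [ENNReal.mul_rpow_of_nonneg _ _ (hw _ _)]
  rw [Finset.prod_mul_distrib, Fintype.prod_prod_type, Fintype.prod_prod_type_right]
  simp only [prod_rpow_eq_rpow_sum _ _ (hw _), hw_symm _, hw_sum, rpow_half]
  rw [← Finset.prod_mul_distrib]
  refine Finset.prod_congr rfl fun j _ => ?_
  rw [← ENNReal.rpow_add_of_nonneg _ _ one_half_pos.le one_half_pos.le, add_halves,
    ENNReal.rpow_one]

/-- Hölder's inequality over all pairs `(j, k)` of linear forms, the pair having weight half its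
squared determinant: each pair is a linear change of variables in the plane. -/
lemma lintegral_prod_comp_linear_le (hΨ : Measurable Ψ) (hΨ0 : Ψ 0 = 1)
    (hB : ∀ r : ℝ, 0 < r → r ≤ 1 / 2 → ∫⁻ t, Ψ t ^ r⁻¹ ≤ B * ENNReal.ofReal √r)
    (ha : ∑ j, a j ^ 2 = 1) (hb : ∑ j, b j ^ 2 = 1) (hab : ∑ j, a j * b j = 0)
    (hr : ∀ j, a j ^ 2 + b j ^ 2 ≤ 1 / 2) :
    ∫⁻ θ : ℝ × ℝ, ∏ j, Ψ (a j * θ.1 + b j * θ.2) ≤ ENNReal.ofReal (Real.exp 1) * B ^ 2 := by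
  set r : ι → ℝ := fun j => a j ^ 2 + b j ^ 2
  set w : ι → ι → ℝ := fun j k => (a j * b k - b j * a k) ^ 2 / 2 with w_def
  have sum_r : ∑ j, r j = 2 := by
    rw [Finset.sum_add_distrib, ha, hb]
    norm_num
  have w_nonneg (j k : ι) : 0 ≤ w j k := by positivity
  have w_symm (j k : ι) : w j k = w k j := by
    simp only [w_def]
    ring
  have sum_w_row (j : ι) : ∑ k, w j k = r j / 2 := by
    rw [← Finset.sum_div, sum_cross_sq ha hb hab, mul_one, mul_one]
  have sum_w : ∑ p : ι × ι, w p.1 p.2 = 1 := by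
    simp_rw [Fintype.sum_prod_type, sum_w_row, ← Finset.sum_div, sum_r]
    norm_num
  have form_eq_one (θ : ℝ × ℝ) (j : ι) (hj : r j = 0) : Ψ (a j * θ.1 + b j * θ.2) = 1 := by
    obtain ⟨a_sq, b_sq⟩ := (add_eq_zero_iff_of_nonneg (sq_nonneg (a j)) (sq_nonneg (b j))).mp hj
    simp [pow_eq_zero_iff two_ne_zero |>.mp a_sq, pow_eq_zero_iff two_ne_zero |>.mp b_sq, hΨ0]
  calc ∫⁻ θ : ℝ × ℝ, ∏ j, Ψ (a j * θ.1 + b j * θ.2)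
      = ∫⁻ θ : ℝ × ℝ, ∏ p : ι × ι, (Ψ (a p.1 * θ.1 + b p.1 * θ.2) ^ (r p.1)⁻¹ *
          Ψ (a p.2 * θ.1 + b p.2 * θ.2) ^ (r p.2)⁻¹) ^ w p.1 p.2 :=
        lintegral_congr fun θ =>
          prod_eq_prod_pair_rpow (form_eq_one θ) w_nonneg w_symm sum_w_row
    _ ≤ ∏ p : ι × ι, (∫⁻ θ : ℝ × ℝ, Ψ (a p.1 * θ.1 + b p.1 * θ.2) ^ (r p.1)⁻¹ *
          Ψ (a p.2 * θ.1 + b p.2 * θ.2) ^ (r p.2)⁻¹) ^ w p.1 p.2 :=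
        ENNReal.lintegral_prod_norm_pow_le _
          (fun p _ => (by fun_prop : Measurable _).aemeasurable) sum_w fun p _ => w_nonneg _ _
    _ ≤ ∏ p : ι × ι, ((B ^ 2) ^ w p.1 p.2 * ENNReal.ofReal (Real.exp (r p.1 * r p.2 / 4))) :=
        Finset.prod_le_prod' fun p _ => lintegral_pair_rpow_le hΨ hB (hr _) (hr _)
    _ = ENNReal.ofReal (Real.exp 1) * B ^ 2 := by
        rw [Finset.prod_mul_distrib, prod_rpow_eq_rpow_sum _ _ fun p => w_nonneg _ _, sum_w,
          ENNReal.rpow_one, ← ENNReal.ofReal_prod_of_nonneg fun p _ => (Real.exp_pos _).le,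
          ← Real.exp_sum, Fintype.sum_prod_type, mul_comm]
        simp_rw [← Finset.sum_div, ← Finset.mul_sum, sum_r, ← Finset.sum_mul, sum_r]
        norm_num

end HolderLinearForms

section SmallBall

lemma measure_pi_le_mul_of_update_le {κ : Type*} [Fintype κ] [DecidableEq κ] {X : κ → Type*}
    [∀ i, MeasurableSpace (X i)] (ν : ∀ i, Measure (X i)) [∀ i, SigmaFinite (ν i)] (j : κ)
    {S T : Set (∀ i, X i)} (hS : MeasurableSet S) (hT : MeasurableSet T) (c : ENNReal)
    (h : ∀ g, ν j {y | Function.update g j y ∈ S} ≤ c * ν j {y | Function.update g j y ∈ T}) :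
    Measure.pi ν S ≤ c * Measure.pi ν T := by
  have lintegral_slice {U : Set (∀ i, X i)} (hU : MeasurableSet U) (g : ∀ i, X i) :
      ∫⁻ y, U.indicator 1 (Function.update g j y) ∂ν j = ν j {y | Function.update g j y ∈ U} :=
    lintegral_indicator_one (measurable_update g hU)
  rw [← lintegral_indicator_one hS, ← lintegral_indicator_one hT,
    ← lintegral_const_mul _ (measurable_one.indicator hT)]
  refine lintegral_le_of_lmarginal_le {j} (measurable_one.indicator hS)
    ((measurable_one.indicator hT).const_mul _) fun g => ?_
  have measurable_slice : Measurable fun y =>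
      T.indicator (1 : (∀ i, X i) → ENNReal) (Function.update g j y) :=
    (measurable_one.indicator hT).comp (measurable_update g)
  simp only [lmarginal_singleton]
  rw [lintegral_const_mul c measurable_slice, lintegral_slice hS, lintegral_slice hT]
  exact h g

variable {μ : Measure ℝ} {K : ℝ}

lemma measure_norm_smul_add_le {V : Type*} [NormedAddCommGroup V] [NormedSpace ℝ V]
    (hμ : μ ≤ ENNReal.ofReal K • volume) {v : V} (hv : v ≠ 0) (c : V) (r : ℝ) :
    μ {y : ℝ | ‖y • v + c‖ ≤ r} ≤ ENNReal.ofReal K * ENNReal.ofReal (2 * r / ‖v‖) := by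
  refine (hμ _).trans ?_
  rw [Measure.smul_apply, smul_eq_mul]
  gcongr
  refine (Real.volume_le_diam _).trans (Metric.ediam_le fun y hy y' hy' => ?_)
  rw [edist_dist, Real.dist_eq]
  refine ENNReal.ofReal_le_ofReal ?_
  rw [le_div_iff₀ (norm_pos_iff.mpr hv), two_mul]
  calc |y - y'| * ‖v‖ = ‖(y • v + c) - (y' • v + c)‖ := by
        rw [add_sub_add_right_eq_sub, ← sub_smul, norm_smul, Real.norm_eq_abs]
    _ ≤ ‖y • v + c‖ + ‖y' • v + c‖ := norm_sub_le _ _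
    _ ≤ r + r := add_le_add hy hy'

variable {ι : Type*} [Fintype ι]

lemma abs_sum_mul_cross_sub_le (v : ι → ℂ) (w x : ℂ) (g : ι → ℝ) :
    |∑ k, g k * (w.re * (v k).im - w.im * (v k).re) - (starRingEnd ℂ w * x).im|
      ≤ ‖w‖ * ‖∑ k, g k • v k - x‖ := by
  have form_eq : ∑ k, g k * (w.re * (v k).im - w.im * (v k).re) - (starRingEnd ℂ w * x).im
      = (starRingEnd ℂ w * (∑ k, g k • v k - x)).im := by
    rw [mul_sub, Finset.mul_sum, Complex.sub_im, Complex.im_sum]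
    congr 1
    refine Finset.sum_congr rfl fun k _ => ?_
    simp only [Complex.mul_im, Complex.conj_re, Complex.conj_im, Complex.smul_re, Complex.smul_im,
      smul_eq_mul]
    ring
  calc |∑ k, g k * (w.re * (v k).im - w.im * (v k).re) - (starRingEnd ℂ w * x).im|
      ≤ ‖starRingEnd ℂ w * (∑ k, g k • v k - x)‖ := form_eq ▸ Complex.abs_im_le_norm _
    _ = ‖w‖ * ‖∑ k, g k • v k - x‖ := by rw [norm_mul, RCLike.norm_conj]

variable [IsProbabilityMeasure μ]

lemma measure_pi_inter_norm_sum_smul_sub_le {V : Type*} [NormedAddCommGroup V] [NormedSpace ℝ V]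
    [DecidableEq ι] (hμ : μ ≤ ENNReal.ofReal K • volume) {v : ι → V} {j : ι} (hj : v j ≠ 0)
    (x : V) (r : ℝ) {T : Set (ι → ℝ)} (hT : MeasurableSet T)
    (hTj : ∀ g y, Function.update g j y ∈ T ↔ g ∈ T) :
    (Measure.pi fun _ : ι => μ) (T ∩ {g | ‖∑ k, g k • v k - x‖ ≤ r})
      ≤ ENNReal.ofReal K * ENNReal.ofReal (2 * r / ‖v j‖) * (Measure.pi fun _ : ι => μ) T := by
  have measurableSet_ball : MeasurableSet {g : ι → ℝ | ‖∑ k, g k • v k - x‖ ≤ r} :=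
    (isClosed_le (by fun_prop) continuous_const).measurableSet
  refine measure_pi_le_mul_of_update_le _ j (hT.inter measurableSet_ball) hT _ fun g => ?_
  by_cases hg : g ∈ T
  · have sum_update (y : ℝ) : ∑ k, Function.update g j y k • v k - x
        = y • v j + (∑ k ∈ Finset.univ.erase j, g k • v k - x) := by
      rw [← Finset.add_sum_erase _ _ (Finset.mem_univ j), Function.update_self, add_sub_assoc]
      congr 2
      exact Finset.sum_congr rfl fun k hk => by
        rw [Function.update_of_ne (Finset.ne_of_mem_erase hk)]
    simpa [hTj, hg, sum_update] using measure_norm_smul_add_le hμ hj _ r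
  · simp [hTj, hg]

/-- If one coefficient carries half of the mass, conditioning on the other variables suffices;
otherwise Hölder's inequality applies to the characteristic function of the sum. -/
lemma measure_pi_abs_sum_mul_sub_le_of_sum_sq_eq_one (hμ : μ ≤ ENNReal.ofReal K • volume)
    {a : ι → ℝ} (ha : ∑ j, a j ^ 2 = 1) (x : ℝ) {s : ℝ} (hs : 0 < s) :
    (Measure.pi fun _ : ι => μ) {g | |∑ j, g j * a j - x| ≤ s}
      ≤ ENNReal.ofReal (200 * K * s) := by
  classical
  have hK := pos_of_le_ofReal_smul_volume hμ
  by_cases large : ∃ j, 1 / 2 < a j ^ 2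
  · obtain ⟨j, hj⟩ := large
    have half_le : 1 / 2 ≤ |a j| := by
      rw [← sq_abs] at hj
      nlinarith [abs_nonneg (a j)]
    have slab := measure_pi_inter_norm_sum_smul_sub_le hμ (v := a) (j := j)
      (abs_pos.mp (by linarith)) x s MeasurableSet.univ (by simp)
    rw [Set.univ_inter, measure_univ, mul_one, ← ENNReal.ofReal_mul hK.le] at slab
    refine slab.trans (ENNReal.ofReal_le_ofReal ?_)
    rw [Real.norm_eq_abs]
    calc K * (2 * s / |a j|) ≤ K * (2 * s / (1 / 2)) := by gcongr
      _ ≤ 200 * K * s := by nlinarith [mul_pos hK hs]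
  · push Not at large
    have esseen := measure_pi_norm_sum_smul_sub_le_lintegral_charFun (μ := μ) a x hs
    have hölder := lintegral_prod_comp_mul_le (Ψ := fun t => ‖charFun μ t‖ₑ)
      measurable_charFun.enorm (by simp) (fun r => lintegral_enorm_charFun_rpow_inv_le hμ) ha large
    simp only [Module.finrank_self, pow_one, RCLike.inner_apply, conj_trivial] at esseen
    calc _ ≤ ENNReal.ofReal (2 * s) * ENNReal.ofReal (100 * K) := by
          refine esseen.trans ?_
          gcongr
          simpa only [mul_comm] using hölder
      _ = ENNReal.ofReal (200 * K * s) := by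
          rw [← ENNReal.ofReal_mul (by positivity)]
          ring_nf

lemma measure_pi_abs_sum_mul_sub_le (hμ : μ ≤ ENNReal.ofReal K • volume) {a : ι → ℝ} {A : ℝ}
    (hA : 0 < A) (ha : ∑ j, a j ^ 2 = A ^ 2) (x : ℝ) {s : ℝ} (hs : 0 < s) :
    (Measure.pi fun _ : ι => μ) {g | |∑ j, g j * a j - x| ≤ s}
      ≤ ENNReal.ofReal (200 * K * (s / A)) := by
  have normalized : ∑ j, (a j / A) ^ 2 = 1 := by
    simp_rw [div_pow, ← Finset.sum_div, ha]
    exact div_self (by positivity)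
  convert measure_pi_abs_sum_mul_sub_le_of_sum_sq_eq_one hμ normalized (x / A) (div_pos hs hA)
    using 4 with g
  simp_rw [← mul_div_assoc, ← Finset.sum_div, ← sub_div, abs_div, abs_of_pos hA,
    div_le_div_iff_of_pos_right hA]

lemma lintegral_prod_enorm_charFun_inner_le (hμ : μ ≤ ENNReal.ofReal K • volume) {v : ι → ℂ}
    {A B : ℝ} (hA : 0 < A) (hB : 0 < B) (hre : ∑ j, (v j).re ^ 2 = A ^ 2)
    (him : ∑ j, (v j).im ^ 2 = B ^ 2) (hcross : ∑ j, (v j).re * (v j).im = 0)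
    (hsmall : ∀ j, ((v j).re / A) ^ 2 + ((v j).im / B) ^ 2 ≤ 1 / 2) :
    ∫⁻ t : ℂ, ∏ j, ‖charFun μ (inner ℝ (v j) t)‖ₑ
      ≤ ENNReal.ofReal (30000 * K ^ 2 / (A * B)) := by
  have hK := pos_of_le_ofReal_smul_volume hμ
  have hölder := lintegral_prod_comp_linear_le (Ψ := fun t => ‖charFun μ t‖ₑ)
    (a := fun j => (v j).re / A) (b := fun j => (v j).im / B) measurable_charFun.enorm (by simp)
    (fun r => lintegral_enorm_charFun_rpow_inv_le hμ)
    (by simp_rw [div_pow, ← Finset.sum_div, hre]; exact div_self (by positivity))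
    (by simp_rw [div_pow, ← Finset.sum_div, him]; exact div_self (by positivity))
    (by simp_rw [div_mul_div_comm, ← Finset.sum_div, hcross, zero_div]) hsmall
  set F : ℝ × ℝ → ENNReal := fun η =>
    ∏ j, ‖charFun μ ((v j).re / A * η.1 + (v j).im / B * η.2)‖ₑ
  have measurable_F : Measurable F := by
    have := measurable_charFun (μ := μ)
    fun_prop
  calc ∫⁻ t : ℂ, ∏ j, ‖charFun μ (inner ℝ (v j) t)‖ₑ
      = ∫⁻ θ : ℝ × ℝ, F (A * θ.1 + 0 * θ.2, 0 * θ.1 + B * θ.2) := by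
        rw [← Complex.volume_preserving_equiv_real_prod.lintegral_comp (by fun_prop)]
        refine lintegral_congr fun t => Finset.prod_congr rfl fun j _ => ?_
        congr 2
        simp only [Complex.inner, Complex.mul_re, Complex.conj_re, Complex.conj_im,
          Complex.measurableEquivRealProd_apply]
        field_simp
        ring_nf
    _ = ENNReal.ofReal |(A * B - 0 * 0)⁻¹| * ∫⁻ η, F η :=
        lintegral_comp_linear_prod measurable_F (by simp [hA.ne', hB.ne'])
    _ ≤ ENNReal.ofReal |(A * B - 0 * 0)⁻¹| *
          (ENNReal.ofReal (Real.exp 1) * ENNReal.ofReal (100 * K) ^ 2) := by gcongr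
    _ ≤ ENNReal.ofReal (30000 * K ^ 2 / (A * B)) := by
        rw [← ENNReal.ofReal_pow (by positivity), ← ENNReal.ofReal_mul (by positivity),
          ← ENNReal.ofReal_mul (by positivity), zero_mul, sub_zero, abs_of_pos (by positivity),
          inv_mul_eq_div]
        refine ENNReal.ofReal_le_ofReal (div_le_div_of_nonneg_right ?_ (by positivity))
        nlinarith [Real.exp_one_lt_d9, sq_pos_of_pos hK]

lemma le_sqrt_sum_cross_sq {a b : ι → ℝ} {A B : ℝ} (hA : 0 < A) (hB : 0 < B)
    (ha : ∑ j, a j ^ 2 = A ^ 2) (hb : ∑ j, b j ^ 2 = B ^ 2) (hab : ∑ j, a j * b j = 0) {j : ι}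
    (hj : 1 / 2 < (a j / A) ^ 2 + (b j / B) ^ 2) :
    A * B / 2 ≤ √(∑ k, (a j * b k - b j * a k) ^ 2) := by
  refine Real.le_sqrt_of_sq_le ?_
  calc (A * B / 2) ^ 2 ≤ (A * B) ^ 2 * ((a j / A) ^ 2 + (b j / B) ^ 2) := by
        nlinarith [mul_pos hA hB]
    _ = ∑ k, (a j * b k - b j * a k) ^ 2 := by
        rw [sum_cross_sq ha hb hab]
        field_simp

/-- Conditioning on the real form `∑ k, Im (conj (v j) * v k) * g k`, which does not involve
`g j`. -/
lemma measure_pi_norm_sum_smul_sub_le_of_large (hμ : μ ≤ ENNReal.ofReal K • volume) {v : ι → ℂ}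
    {A B : ℝ} (hA : 0 < A) (hB : 0 < B) (hre : ∑ j, (v j).re ^ 2 = A ^ 2)
    (him : ∑ j, (v j).im ^ 2 = B ^ 2) (hcross : ∑ j, (v j).re * (v j).im = 0) {j : ι}
    (hlarge : 1 / 2 < ((v j).re / A) ^ 2 + ((v j).im / B) ^ 2) (x : ℂ) {r : ℝ} (hr : 0 < r) :
    (Measure.pi fun _ : ι => μ) {g | ‖∑ k, g k • v k - x‖ ≤ r}
      ≤ ENNReal.ofReal (800 * K ^ 2 * r ^ 2 / (A * B)) := by
  classical
  have hK := pos_of_le_ofReal_smul_volume hμ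
  have v_ne_zero : v j ≠ 0 := fun h => by norm_num [h] at hlarge
  have : 0 < ‖v j‖ := norm_pos_iff.mpr v_ne_zero
  set c : ι → ℝ := fun k => (v j).re * (v k).im - (v j).im * (v k).re with c_def
  have le_sqrt_sum_c_sq : A * B / 2 ≤ √(∑ k, c k ^ 2) :=
    le_sqrt_sum_cross_sq hA hB hre him hcross hlarge
  set T : Set (ι → ℝ) := {g | |∑ k, g k * c k - (starRingEnd ℂ (v j) * x).im| ≤ ‖v j‖ * r}
    with T_def
  have update_mem_T (g : ι → ℝ) (y : ℝ) : Function.update g j y ∈ T ↔ g ∈ T := by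
    have : ∑ k, Function.update g j y k * c k = ∑ k, g k * c k :=
      Finset.sum_congr rfl fun k _ => by
        by_cases hk : k = j
        · simp [c_def, hk, mul_comm]
        · rw [Function.update_of_ne hk]
    simp only [T_def, Set.mem_ofPred_eq, this]
  have subset_T : {g : ι → ℝ | ‖∑ k, g k • v k - x‖ ≤ r} ⊆ T := fun g hg =>
    (abs_sum_mul_cross_sub_le v (v j) x g).trans (mul_le_mul_of_nonneg_left hg (norm_nonneg _))
  calc (Measure.pi fun _ : ι => μ) {g | ‖∑ k, g k • v k - x‖ ≤ r}
      = (Measure.pi fun _ : ι => μ) (T ∩ {g | ‖∑ k, g k • v k - x‖ ≤ r}) := by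
        rw [Set.inter_eq_right.mpr subset_T]
    _ ≤ ENNReal.ofReal K * ENNReal.ofReal (2 * r / ‖v j‖) * (Measure.pi fun _ : ι => μ) T :=
        measure_pi_inter_norm_sum_smul_sub_le hμ v_ne_zero x r
          (measurableSet_le (by fun_prop) measurable_const) update_mem_T
    _ ≤ ENNReal.ofReal K * ENNReal.ofReal (2 * r / ‖v j‖)
          * ENNReal.ofReal (200 * K * (‖v j‖ * r / √(∑ k, c k ^ 2))) := by
        gcongr
        exact measure_pi_abs_sum_mul_sub_le hμ (lt_of_lt_of_le (by positivity) le_sqrt_sum_c_sq)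
          (Real.sq_sqrt (by positivity)).symm _ (by positivity)
    _ ≤ ENNReal.ofReal (K * (2 * r / ‖v j‖) * (200 * K * (‖v j‖ * r / (A * B / 2)))) := by
        rw [← ENNReal.ofReal_mul hK.le, ← ENNReal.ofReal_mul (by positivity)]
        gcongr
    _ = ENNReal.ofReal (800 * K ^ 2 * r ^ 2 / (A * B)) := by
        congr 1
        field_simp
        ring

lemma measure_pi_norm_sum_smul_sub_le (hμ : μ ≤ ENNReal.ofReal K • volume) {v : ι → ℂ} {A B : ℝ}
    (hA : 0 < A) (hB : 0 < B) (hre : ∑ j, (v j).re ^ 2 = A ^ 2)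
    (him : ∑ j, (v j).im ^ 2 = B ^ 2) (hcross : ∑ j, (v j).re * (v j).im = 0) (x : ℂ) {r : ℝ}
    (hr : 0 < r) :
    (Measure.pi fun _ : ι => μ) {g | ‖∑ j, g j • v j - x‖ ≤ r}
      ≤ ENNReal.ofReal (60000 * K ^ 2 * r ^ 2 / (A * B)) := by
  by_cases large : ∃ j, 1 / 2 < ((v j).re / A) ^ 2 + ((v j).im / B) ^ 2
  · obtain ⟨j, hj⟩ := large
    refine (measure_pi_norm_sum_smul_sub_le_of_large hμ hA hB hre him hcross hj x hr).trans
      (ENNReal.ofReal_le_ofReal ?_)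
    gcongr
    norm_num
  · push Not at large
    calc (Measure.pi fun _ : ι => μ) {g | ‖∑ j, g j • v j - x‖ ≤ r}
        ≤ ENNReal.ofReal (2 * r ^ 2) * ENNReal.ofReal (30000 * K ^ 2 / (A * B)) := by
          refine (measure_pi_norm_sum_smul_sub_le_lintegral_charFun v x hr).trans ?_
          rw [Complex.finrank_real_complex]
          gcongr
          exact lintegral_prod_enorm_charFun_inner_le hμ hA hB hre him hcross large
      _ = ENNReal.ofReal (60000 * K ^ 2 * r ^ 2 / (A * B)) := by
          rw [← ENNReal.ofReal_mul (by positivity)]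
          ring_nf

end SmallBall

section OrthogonalParts

variable {m : Type*}

/-- The vector of real parts of a complex vector. -/
def reVec (u : EuclideanSpace ℂ m) : EuclideanSpace ℝ m :=
  WithLp.toLp 2 fun j => (u j).re

/-- The vector of imaginary parts of a complex vector. -/
def imVec (u : EuclideanSpace ℂ m) : EuclideanSpace ℝ m :=
  WithLp.toLp 2 fun j => (u j).im

variable [Fintype m]

lemma norm_reVec_sq_add_norm_imVec_sq (u : EuclideanSpace ℂ m) :
    ‖reVec u‖ ^ 2 + ‖imVec u‖ ^ 2 = ‖u‖ ^ 2 := by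
  rw [EuclideanSpace.real_norm_sq_eq, EuclideanSpace.real_norm_sq_eq, EuclideanSpace.norm_sq_eq,
    ← Finset.sum_add_distrib]
  simp only [reVec, imVec, Complex.sq_norm, Complex.normSq_apply, ← sq]

lemma inner_reVec_imVec (u : EuclideanSpace ℂ m) :
    inner ℝ (reVec u) (imVec u) = ∑ j, (u j).re * (u j).im := by
  simp [PiLp.inner_apply, reVec, imVec, mul_comm]

lemma sum_sq_re (u : EuclideanSpace ℂ m) :
    (∑ j, u j ^ 2).re = ‖reVec u‖ ^ 2 - ‖imVec u‖ ^ 2 := by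
  rw [EuclideanSpace.real_norm_sq_eq, EuclideanSpace.real_norm_sq_eq, Complex.re_sum,
    ← Finset.sum_sub_distrib]
  simp only [reVec, imVec, sq, Complex.mul_re]

lemma sum_sq_im (u : EuclideanSpace ℂ m) :
    (∑ j, u j ^ 2).im = 2 * inner ℝ (reVec u) (imVec u) := by
  rw [inner_reVec_imVec, Complex.im_sum, Finset.mul_sum]
  exact Finset.sum_congr rfl fun j _ => by rw [sq, Complex.mul_im]; ring

lemma exists_norm_eq_one_sq_mul_eq_norm (s : ℂ) : ∃ c : ℂ, ‖c‖ = 1 ∧ c ^ 2 * s = ‖s‖ := by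
  refine ⟨Complex.exp ((-(s.arg / 2) : ℝ) * Complex.I), Complex.norm_exp_ofReal_mul_I _, ?_⟩
  have phases_cancel :
      ((2 : ℕ) : ℂ) * ((-(s.arg / 2) : ℝ) * Complex.I) + s.arg * Complex.I = 0 := by
    push_cast
    ring
  nth_rewrite 2 [← Complex.norm_mul_exp_arg_mul_I s]
  rw [mul_left_comm, ← Complex.exp_nat_mul, ← Complex.exp_add, phases_cancel, Complex.exp_zero,
    mul_one]

/-- The phase is chosen to make `∑ j, u j ^ 2`, whose real and imaginary parts are
`‖reVec u‖ ^ 2 - ‖imVec u‖ ^ 2` and `2 ⟪reVec u, imVec u⟫`, a nonnegative real number. -/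
lemma exists_norm_eq_one_orthogonal_parts (u : EuclideanSpace ℂ m) :
    ∃ c : ℂ, ‖c‖ = 1 ∧ ‖imVec (c • u)‖ ≤ ‖reVec (c • u)‖ ∧
      inner ℝ (reVec (c • u)) (imVec (c • u)) = 0 := by
  obtain ⟨c, norm_c, hc⟩ := exists_norm_eq_one_sq_mul_eq_norm (∑ j, u j ^ 2)
  have sum_sq : ∑ j, (c • u) j ^ 2 = (‖∑ j, u j ^ 2‖ : ℂ) := by
    simp only [PiLp.smul_apply, smul_eq_mul, mul_pow, ← Finset.mul_sum, hc]
  have re_eq := sum_sq_re (c • u)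
  have im_eq := sum_sq_im (c • u)
  rw [sum_sq, Complex.ofReal_re] at re_eq
  rw [sum_sq, Complex.ofReal_im] at im_eq
  refine ⟨c, norm_c, abs_le_of_sq_le_sq' ?_ (norm_nonneg _) |>.2, by linarith⟩
  linarith [norm_nonneg (∑ j, u j ^ 2)]

end OrthogonalParts

section NearKernel

lemma exists_norm_eq_one_norm_map_eq_singularValues {𝕜 E F : Type*} [RCLike 𝕜]
    [NormedAddCommGroup E] [InnerProductSpace 𝕜 E] [FiniteDimensional 𝕜 E]
    [NormedAddCommGroup F] [InnerProductSpace 𝕜 F] [FiniteDimensional 𝕜 F]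
    (T : E →ₗ[𝕜] F) {k : ℕ} (hk : k < Module.finrank 𝕜 E) :
    ∃ v : E, ‖v‖ = 1 ∧ ‖T v‖ = T.singularValues k := by
  obtain ⟨w, hw⟩ := (T.hasEigenvalue_adjoint_comp_self_sq_singularValues hk).exists_hasEigenvector
  have norm_map_sq : ‖T w‖ ^ 2 = (T.singularValues k * ‖w‖) ^ 2 := by
    have inner_map : inner 𝕜 (T w) (T w) = (T.singularValues k ^ 2 : ℝ) * inner 𝕜 w w := by
      rw [← LinearMap.adjoint_inner_right, ← LinearMap.comp_apply, hw.apply_eq_smul,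
        inner_smul_right]
      simp
    rw [inner_self_eq_norm_sq_to_K, inner_self_eq_norm_sq_to_K] at inner_map
    rw [mul_pow]
    exact_mod_cast inner_map
  have norm_map : ‖T w‖ = T.singularValues k * ‖w‖ :=
    (sq_eq_sq₀ (norm_nonneg _) (mul_nonneg (T.singularValues_nonneg _) (norm_nonneg _))).mp
      norm_map_sq
  have norm_ne_zero : ‖w‖ ≠ 0 := norm_ne_zero_iff.mpr hw.2
  refine ⟨((‖w‖⁻¹ : ℝ) : 𝕜) • w, ?_, ?_⟩
  · rw [norm_smul, RCLike.norm_ofReal, abs_inv, abs_norm, inv_mul_cancel₀ norm_ne_zero]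
  · rw [map_smul, norm_smul, RCLike.norm_ofReal, abs_inv, abs_norm, norm_map]
    field_simp

lemma exists_one_le_card_mul_norm_sq {𝕜 m : Type*} [RCLike 𝕜] [Fintype m]
    {v : EuclideanSpace 𝕜 m} (hv : ‖v‖ = 1) : ∃ i, 1 ≤ Fintype.card m * ‖v i‖ ^ 2 := by
  have sum_eq : ∑ i, ‖v i‖ ^ 2 = 1 := by rw [← EuclideanSpace.norm_sq_eq, hv, one_pow]
  have nonempty : (Finset.univ : Finset m).Nonempty :=
    Finset.nonempty_of_sum_ne_zero (sum_eq.trans_ne one_ne_zero)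
  obtain ⟨i, -, hi⟩ := Finset.exists_le_of_sum_le (f := fun _ => (1 : ℝ))
    (g := fun i => Fintype.card m * ‖v i‖ ^ 2) nonempty (by simp [← Finset.mul_sum, sum_eq])
  exact ⟨i, hi⟩

open scoped Matrix

variable {m : Type*} [Fintype m]

lemma norm_dotProduct_le (u v : EuclideanSpace ℂ m) : ‖u.ofLp ⬝ᵥ v.ofLp‖ ≤ ‖u‖ * ‖v‖ := by
  have norm_star : ‖WithLp.toLp 2 (star u.ofLp)‖ = ‖u‖ := by simp [EuclideanSpace.norm_eq]
  rw [← norm_star]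
  refine le_of_eq_of_le ?_ (norm_inner_le_norm (𝕜 := ℂ) (WithLp.toLp 2 (star u.ofLp)) v)
  rw [EuclideanSpace.inner_eq_star_dotProduct, star_star, dotProduct_comm]

lemma exists_norm_eq_one_vecMul_eq_zero {𝕜 : Type*} [RCLike 𝕜] (M : Matrix m m 𝕜) (i : m) :
    ∃ u : EuclideanSpace 𝕜 m, ‖u‖ = 1 ∧ ∀ k, k ≠ i → (u.ofLp ᵥ* M) k = 0 := by
  classical
  have det_eq_zero : (M.updateCol i 0).det = 0 :=
    Matrix.det_eq_zero_of_column_eq_zero i fun j => by simp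
  obtain ⟨w, w_ne_zero, hw⟩ := Matrix.exists_vecMul_eq_zero_iff.mpr det_eq_zero
  have norm_ne_zero : ‖WithLp.toLp 2 w‖ ≠ 0 :=
    norm_ne_zero_iff.mpr ((WithLp.toLp_eq_zero 2).not.mpr w_ne_zero)
  refine ⟨((‖WithLp.toLp 2 w‖⁻¹ : ℝ) : 𝕜) • WithLp.toLp 2 w, ?_, fun k hk => ?_⟩
  · rw [norm_smul, RCLike.norm_ofReal, abs_inv, abs_norm, inv_mul_cancel₀ norm_ne_zero]
  · have vecMul_eq_zero : (w ᵥ* M) k = 0 := by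
      simpa [Matrix.vecMul, dotProduct, Matrix.updateCol_ne hk] using congrFun hw k
    rw [WithLp.ofLp_smul, Matrix.smul_vecMul, Pi.smul_apply, vecMul_eq_zero, smul_zero]

lemma exists_annihilator_orthogonal_parts (M : Matrix m m ℂ) (i : m) :
    ∃ u : EuclideanSpace ℂ m, ‖u‖ = 1 ∧ ‖imVec u‖ ≤ ‖reVec u‖ ∧
      inner ℝ (reVec u) (imVec u) = 0 ∧ ∀ k, k ≠ i → (u.ofLp ᵥ* M) k = 0 := by
  obtain ⟨u, norm_u, huM⟩ := exists_norm_eq_one_vecMul_eq_zero M i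
  obtain ⟨c, norm_c, im_le_re, orthogonal⟩ := exists_norm_eq_one_orthogonal_parts u
  refine ⟨c • u, by rw [norm_smul, norm_c, norm_u, mul_one], im_le_re, orthogonal, fun k hk => ?_⟩
  rw [WithLp.ofLp_smul, Matrix.smul_vecMul, Pi.smul_apply, huM k hk, smul_zero]

variable [DecidableEq m]

/-- The matrices which map to norm at most `ε` some unit vector whose `i`-th entry is not smaller
than the average one. A matrix with least singular value at most `ε` belongs to one of these sets,
and membership is a condition on how close the `i`-th column is to the span of the others. -/
def nearKernel (i : m) (ε : ℝ) : Set (Matrix m m ℂ) :=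
  {M | ∃ v : EuclideanSpace ℂ m,
    ‖v‖ = 1 ∧ 1 ≤ Fintype.card m * ‖v i‖ ^ 2 ∧ ‖Matrix.toEuclideanLin M v‖ ≤ ε}

lemma exists_mem_nearKernel_of_leastSingularValue_le {n : ℕ} (hn : 1 ≤ n)
    {M : Matrix (Fin n) (Fin n) ℂ} {ε : ℝ} (h : leastSingularValue M ≤ ε) :
    ∃ i, M ∈ nearKernel i ε := by
  obtain ⟨v, norm_v, hMv⟩ := exists_norm_eq_one_norm_map_eq_singularValues
    (Matrix.toEuclideanLin M) (k := n - 1) (by rw [finrank_euclideanSpace_fin]; omega)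
  obtain ⟨i, hi⟩ := exists_one_le_card_mul_norm_sq norm_v
  exact ⟨i, v, norm_v, hi, hMv.trans_le h⟩

lemma isClosed_nearKernel (i : m) (ε : ℝ) : IsClosed (nearKernel i ε) := by
  set S := Metric.sphere (0 : EuclideanSpace ℂ m) 1
  set Z : Set (S × Matrix m m ℂ) := {q | 1 ≤ Fintype.card m * ‖q.1.1 i‖ ^ 2} ∩
    {q | ‖Matrix.toEuclideanLin q.2 q.1.1‖ ≤ ε}
  have isClosed_Z : IsClosed Z := by
    refine (isClosed_le continuous_const (by fun_prop)).inter
      (isClosed_le (Continuous.norm ?_) continuous_const)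
    simp only [Matrix.toLpLin_apply]
    fun_prop
  convert isClosedMap_snd_of_compactSpace Z isClosed_Z using 1
  ext M
  constructor
  · rintro ⟨v, norm_v, hvi, hMv⟩
    exact ⟨(⟨v, mem_sphere_zero_iff_norm.mpr norm_v⟩, M), ⟨hvi, hMv⟩, rfl⟩
  · rintro ⟨⟨v, M⟩, ⟨hvi, hMv⟩, rfl⟩
    exact ⟨v.1, mem_sphere_zero_iff_norm.mp v.2, hvi, hMv⟩

/-- If `M v` is small then so is `uᵀ M v = (uᵀ M) i * v i`. -/
lemma norm_vecMul_apply_le_of_mem_nearKernel {M : Matrix m m ℂ} {i : m} {ε : ℝ}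
    (hM : M ∈ nearKernel i ε) {u : EuclideanSpace ℂ m} (hu : ‖u‖ = 1)
    (huM : ∀ k, k ≠ i → (u.ofLp ᵥ* M) k = 0) :
    ‖(u.ofLp ᵥ* M) i‖ ≤ ε * √(Fintype.card m) := by
  obtain ⟨v, -, hvi, hMv⟩ := hM
  have pairing : u.ofLp ⬝ᵥ (Matrix.toEuclideanLin M v).ofLp = (u.ofLp ᵥ* M) i * v i := by
    rw [Matrix.toLpLin_apply, Matrix.dotProduct_mulVec, dotProduct]
    exact Finset.sum_eq_single i (fun k _ hk => by rw [huM k hk, zero_mul]) (by simp)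
  have pairing_le : ‖(u.ofLp ᵥ* M) i‖ * ‖v i‖ ≤ ε := by
    rw [← norm_mul, ← pairing]
    refine (norm_dotProduct_le _ _).trans ?_
    rwa [hu, one_mul]
  have one_le : 1 ≤ √(Fintype.card m) * ‖v i‖ := by
    rw [← Real.sqrt_sq (norm_nonneg (v i)), ← Real.sqrt_mul (by positivity)]
    exact Real.one_le_sqrt.mpr hvi
  calc ‖(u.ofLp ᵥ* M) i‖ ≤ ‖(u.ofLp ᵥ* M) i‖ * (√(Fintype.card m) * ‖v i‖) :=
        le_mul_of_one_le_right (norm_nonneg _) one_le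
    _ = ‖(u.ofLp ᵥ* M) i‖ * ‖v i‖ * √(Fintype.card m) := by ring
    _ ≤ ε * √(Fintype.card m) := by gcongr

end NearKernel

section ComplexShift

open scoped Matrix

variable {m : Type*} [DecidableEq m]

/-- The matrix `B - z I`, for a real matrix `B` and a complex number `z`. -/
def complexShift (B : Matrix m m ℝ) (z : ℂ) : Matrix m m ℂ :=
  B.map (fun x : ℝ => (x : ℂ)) - z • 1

lemma continuous_complexShift (z : ℂ) : Continuous fun B : Matrix m m ℝ => complexShift B z :=
  (continuous_id.matrix_map Complex.continuous_ofReal).sub continuous_const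

variable [Fintype m]

lemma vecMul_complexShift_add (u : m → ℂ) (A B : Matrix m m ℝ) (z : ℂ) (k : m) :
    (u ᵥ* complexShift (A + B) z) k = (u ᵥ* complexShift A z) k + ∑ j, B j k • u j := by
  have shift_add : complexShift (A + B) z = complexShift A z + B.map (fun x : ℝ => (x : ℂ)) := by
    rw [complexShift, complexShift, Matrix.map_add _ Complex.ofReal_add, add_sub_right_comm]
  rw [shift_add, Matrix.vecMul_add, Pi.add_apply]
  simp [Matrix.vecMul, dotProduct, mul_comm]

lemma imVec_vecMul_complexShift (u : EuclideanSpace ℂ m) (B : Matrix m m ℝ) (z : ℂ) :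
    imVec (WithLp.toLp 2 (u.ofLp ᵥ* complexShift B z))
      = WithLp.toLp 2 ((imVec u).ofLp ᵥ* B) - z.re • imVec u - z.im • reVec u := by
  ext k
  simp only [complexShift, imVec, reVec, Matrix.vecMul_sub, Matrix.vecMul_smul, Matrix.vecMul_one,
    PiLp.sub_apply, PiLp.smul_apply, Pi.sub_apply, Pi.smul_apply, smul_eq_mul, Complex.sub_im]
  simp only [Matrix.vecMul, dotProduct, Matrix.map_apply, Complex.im_sum, Complex.mul_im,
    Complex.ofReal_re, Complex.ofReal_im, mul_zero, zero_add]
  ring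

lemma norm_vecMul_le (B : Matrix m m ℝ) (p : EuclideanSpace ℝ m) :
    ‖WithLp.toLp 2 (p.ofLp ᵥ* B)‖ ≤ ‖B‖ * ‖p‖ := by
  rw [← Matrix.mulVec_transpose, ← Matrix.conjTranspose_eq_transpose_of_trivial,
    ← Matrix.l2_opNorm_conjTranspose]
  exact Matrix.l2_opNorm_mulVec _ p

/-- A nearly annihilating vector with a small imaginary part would be close to a real vector which
`B` nearly maps to a nonreal multiple of itself. -/
lemma abs_im_le_mul_norm_imVec {B : Matrix m m ℝ} {R : ℝ} (hB : ‖B‖ ≤ R) {z : ℂ}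
    (hz : ‖z‖ ≤ 3 * R) {u : EuclideanSpace ℂ m} (hu : 1 / 2 ≤ ‖reVec u‖ ^ 2)
    (huB : 4 * ‖imVec (WithLp.toLp 2 (u.ofLp ᵥ* complexShift B z))‖ ≤ |z.im|) :
    |z.im| ≤ 10 * R * ‖imVec u‖ := by
  have scaled_reVec : z.im • reVec u = WithLp.toLp 2 ((imVec u).ofLp ᵥ* B) - z.re • imVec u
      - imVec (WithLp.toLp 2 (u.ofLp ᵥ* complexShift B z)) := by
    rw [imVec_vecMul_complexShift, sub_sub_cancel]
  have im_mul_le : |z.im| * ‖reVec u‖ ≤ R * ‖imVec u‖ + 3 * R * ‖imVec u‖ + |z.im| / 4 :=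
    calc |z.im| * ‖reVec u‖ = ‖z.im • reVec u‖ := by rw [norm_smul, Real.norm_eq_abs]
      _ ≤ ‖WithLp.toLp 2 ((imVec u).ofLp ᵥ* B)‖ + ‖z.re • imVec u‖
          + ‖imVec (WithLp.toLp 2 (u.ofLp ᵥ* complexShift B z))‖ := by
        rw [scaled_reVec]
        exact (norm_sub_le _ _).trans (by gcongr; exact norm_sub_le _ _)
      _ ≤ R * ‖imVec u‖ + 3 * R * ‖imVec u‖ + |z.im| / 4 := by
        rw [norm_smul, Real.norm_eq_abs]
        gcongr
        · exact (norm_vecMul_le _ _).trans (by gcongr)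
        · exact (Complex.abs_re_le_norm z).trans hz
        · linarith
  have reVec_ge : 7 / 10 ≤ ‖reVec u‖ := by nlinarith [norm_nonneg (reVec u)]
  nlinarith [mul_le_mul_of_nonneg_left reVec_ge (abs_nonneg z.im), abs_nonneg z.im]

end ComplexShift

section ColumnPerturbation

open scoped Matrix

variable {m : Type*} [Fintype m] [DecidableEq m]

/-- The families of columns `X` for which `A + τ Xᵀ`, whose `k`-th column is that of `A` plus
`τ • X k`, has norm at most `R` and nearly has the eigenvalue `z`, in the sense of
`nearKernel i ε`. -/
def nearEigenvalueColumns (A : Matrix m m ℝ) (τ : ℝ) (z : ℂ) (R ε : ℝ) (i : m) :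
    Set (m → m → ℝ) :=
  {X | ‖A + τ • (Matrix.of X)ᵀ‖ ≤ R ∧ complexShift (A + τ • (Matrix.of X)ᵀ) z ∈ nearKernel i ε}

lemma isClosed_nearEigenvalueColumns (A : Matrix m m ℝ) (τ : ℝ) (z : ℂ) (R ε : ℝ) (i : m) :
    IsClosed (nearEigenvalueColumns A τ z R ε i) := by
  have continuous_matrix : Continuous fun X : m → m → ℝ => A + τ • (Matrix.of X)ᵀ :=
    continuous_const.add (Continuous.const_smul (Continuous.matrix_transpose continuous_id) τ)
  exact (isClosed_le continuous_matrix.norm continuous_const).inter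
    ((isClosed_nearKernel i ε).preimage ((continuous_complexShift z).comp continuous_matrix))

lemma vecMul_complexShift_columns (u : m → ℂ) (A : Matrix m m ℝ) (τ : ℝ) (X : m → m → ℝ) (z : ℂ)
    (k : m) :
    (u ᵥ* complexShift (A + τ • (Matrix.of X)ᵀ) z) k
      = (u ᵥ* complexShift A z) k + τ • ∑ j, X k j • u j := by
  rw [vecMul_complexShift_add, Finset.smul_sum]
  simp only [Matrix.smul_apply, Matrix.transpose_apply, Matrix.of_apply, smul_assoc]

/-- The vector annihilates all columns of `A + τ Xᵀ - z` but the `i`-th, so it does not depend on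
the column which varies. -/
lemma exists_slice_nearEigenvalueColumns (A : Matrix m m ℝ) {τ : ℝ} (hτ : 0 < τ) {z : ℂ} {R : ℝ}
    (hz : ‖z‖ ≤ 3 * R) (ε : ℝ) (i : m) (X : m → m → ℝ) :
    ∃ (u : EuclideanSpace ℂ m) (x : ℂ), 1 / 2 ≤ ‖reVec u‖ ∧ inner ℝ (reVec u) (imVec u) = 0 ∧
      ∀ y, Function.update X i y ∈ nearEigenvalueColumns A τ z R ε i →
        ‖∑ j, y j • u j - x‖ ≤ ε * √(Fintype.card m) / τ ∧
        (4 * (ε * √(Fintype.card m)) ≤ |z.im| → |z.im| ≤ 10 * R * ‖imVec u‖) := by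
  obtain ⟨u, norm_u, im_le_re, orthogonal, annihilates⟩ :=
    exists_annihilator_orthogonal_parts (complexShift (A + τ • (Matrix.of X)ᵀ) z) i
  have half_le_sq : 1 / 2 ≤ ‖reVec u‖ ^ 2 := by
    have := norm_reVec_sq_add_norm_imVec_sq u
    rw [norm_u] at this
    nlinarith [norm_nonneg (imVec u)]
  refine ⟨u, -(τ⁻¹ • (u.ofLp ᵥ* complexShift A z) i), by nlinarith [norm_nonneg (reVec u)],
    orthogonal, fun y hy => ?_⟩
  set M := complexShift (A + τ • (Matrix.of (Function.update X i y))ᵀ) z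
  have vecMul_of_ne (k : m) (hk : k ≠ i) : (u.ofLp ᵥ* M) k = 0 := by
    rw [← annihilates k hk, vecMul_complexShift_columns, vecMul_complexShift_columns,
      Function.update_of_ne hk]
  have vecMul_self : (u.ofLp ᵥ* M) i
      = τ • (∑ j, y j • u j - -(τ⁻¹ • (u.ofLp ᵥ* complexShift A z) i)) := by
    rw [vecMul_complexShift_columns, Function.update_self, sub_neg_eq_add, smul_add,
      smul_inv_smul₀ hτ.ne', add_comm]
  have norm_vecMul_self := norm_vecMul_apply_le_of_mem_nearKernel hy.2 norm_u vecMul_of_ne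
  have norm_vecMul : ‖WithLp.toLp 2 (u.ofLp ᵥ* M)‖ = ‖(u.ofLp ᵥ* M) i‖ := by
    rw [EuclideanSpace.norm_eq, Finset.sum_eq_single i (by simp +contextual [vecMul_of_ne])
      (by simp), Real.sqrt_sq (norm_nonneg _)]
  refine ⟨?_, fun hε => abs_im_le_mul_norm_imVec hy.1 hz half_le_sq (le_trans ?_ hε)⟩
  · rw [le_div_iff₀' hτ]
    rwa [vecMul_self, norm_smul, Real.norm_of_nonneg hτ.le] at norm_vecMul_self
  · rw [← norm_vecMul] at norm_vecMul_self
    gcongr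
    refine le_trans ?_ norm_vecMul_self
    refine le_of_sq_le_sq ?_ (norm_nonneg _)
    rw [← norm_reVec_sq_add_norm_imVec_sq (WithLp.toLp 2 (u.ofLp ᵥ* M))]
    exact le_add_of_nonneg_left (sq_nonneg _)

end ColumnPerturbation

section NearEigenvalueProbability

variable {μ : Measure ℝ} [IsProbabilityMeasure μ] {K : ℝ} {m : Type*} [Fintype m]

lemma measure_pi_norm_sum_smul_sub_le_of_le_norm_reVec (hμ : μ ≤ ENNReal.ofReal K • volume)
    {u : EuclideanSpace ℂ m} (hu : 1 / 2 ≤ ‖reVec u‖) (x : ℂ) {s : ℝ} (hs : 0 < s) :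
    (Measure.pi fun _ : m => μ) {y | ‖∑ j, y j • u j - x‖ ≤ s} ≤ ENNReal.ofReal (400 * K * s) := by
  have hK := pos_of_le_ofReal_smul_volume hμ
  have subset_slab : {y : m → ℝ | ‖∑ j, y j • u j - x‖ ≤ s}
      ⊆ {y | |∑ j, y j * reVec u j - x.re| ≤ s} := fun y hy => by
    simpa [reVec, Complex.re_sum] using (Complex.abs_re_le_norm _).trans hy
  calc _ ≤ _ := measure_mono subset_slab
    _ ≤ ENNReal.ofReal (200 * K * (s / ‖reVec u‖)) :=
        measure_pi_abs_sum_mul_sub_le hμ (by linarith)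
          (EuclideanSpace.real_norm_sq_eq (reVec u)).symm x.re hs
    _ ≤ ENNReal.ofReal (200 * K * (s / (1 / 2))) := by gcongr
    _ = ENNReal.ofReal (400 * K * s) := by ring_nf

lemma measure_pi_norm_sum_smul_sub_le_of_le_norm_imVec (hμ : μ ≤ ENNReal.ofReal K • volume)
    {u : EuclideanSpace ℂ m} (hu : 1 / 2 ≤ ‖reVec u‖)
    (orthogonal : inner ℝ (reVec u) (imVec u) = 0) {b : ℝ} (hb : 0 < b) (hbu : b ≤ ‖imVec u‖)
    (x : ℂ) {s : ℝ} (hs : 0 < s) :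
    (Measure.pi fun _ : m => μ) {y | ‖∑ j, y j • u j - x‖ ≤ s}
      ≤ ENNReal.ofReal (120000 * K ^ 2 * s ^ 2 / b) := by
  refine (measure_pi_norm_sum_smul_sub_le hμ (A := ‖reVec u‖) (B := ‖imVec u‖) (by linarith)
    (hb.trans_le hbu) (EuclideanSpace.real_norm_sq_eq (reVec u)).symm
    (EuclideanSpace.real_norm_sq_eq (imVec u)).symm ?_ x hs).trans (ENNReal.ofReal_le_ofReal ?_)
  · rw [← inner_reVec_imVec, orthogonal]
  · calc 60000 * K ^ 2 * s ^ 2 / (‖reVec u‖ * ‖imVec u‖)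
        ≤ 60000 * K ^ 2 * s ^ 2 / (1 / 2 * b) := by gcongr
      _ = 120000 * K ^ 2 * s ^ 2 / b := by field_simp; ring

variable [DecidableEq m]

/-- For `ε √N` smaller than `|Im z|` the imaginary part of the annihilator is not small and the
small ball estimate in the plane applies; otherwise the one on the line suffices. -/
lemma measure_slice_nearEigenvalueColumns_le (hμ : μ ≤ ENNReal.ofReal K • volume)
    (A : Matrix m m ℝ) {τ R : ℝ} (hτ : 0 < τ) (hτR : τ ≤ R) {z : ℂ} (hz : ‖z‖ ≤ 3 * R)
    (hz_im : z.im ≠ 0) {s : ℝ} (hs : 0 < s) {ε : ℝ} (hε : ε * √(Fintype.card m) = s * τ) (i : m)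
    (X : m → m → ℝ) :
    (Measure.pi fun _ : m => μ)
        {y | Function.update X i y ∈ nearEigenvalueColumns A τ z R ε i}
      ≤ ENNReal.ofReal (1200000 * R * (max K (K ^ 2) * s ^ 2 / |z.im|)) := by
  have hK := pos_of_le_ofReal_smul_volume hμ
  have hR : 0 < R := hτ.trans_le hτR
  have : 0 < |z.im| := abs_pos.mpr hz_im
  obtain ⟨u, x, half_le, orthogonal, slice⟩ :=
    exists_slice_nearEigenvalueColumns A hτ hz ε i X
  rw [hε, mul_div_cancel_right₀ _ hτ.ne'] at slice
  have slice_subset : {y | Function.update X i y ∈ nearEigenvalueColumns A τ z R ε i}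
      ⊆ {y | ‖∑ j, y j • u j - x‖ ≤ s} := fun y hy => (slice y hy).1
  obtain empty | ⟨y, hy⟩ :=
    Set.eq_empty_or_nonempty {y | Function.update X i y ∈ nearEigenvalueColumns A τ z R ε i}
  · rw [empty, measure_empty]
    exact zero_le
  refine (measure_mono slice_subset).trans ?_
  rcases le_or_gt (4 * (s * τ)) |z.im| with small | large
  · have le_norm_imVec : |z.im| / (10 * R) ≤ ‖imVec u‖ := by
      rw [div_le_iff₀' (by positivity)]
      exact (slice y hy).2 small
    refine (measure_pi_norm_sum_smul_sub_le_of_le_norm_imVec hμ half_le orthogonal (by positivity)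
      le_norm_imVec x hs).trans (ENNReal.ofReal_le_ofReal ?_)
    calc 120000 * K ^ 2 * s ^ 2 / (|z.im| / (10 * R))
        = 1200000 * R * (K ^ 2 * s ^ 2 / |z.im|) := by field_simp; norm_num
      _ ≤ 1200000 * R * (max K (K ^ 2) * s ^ 2 / |z.im|) := by gcongr; exact le_max_right _ _
  · refine (measure_pi_norm_sum_smul_sub_le_of_le_norm_reVec hμ half_le x hs).trans
      (ENNReal.ofReal_le_ofReal ?_)
    have abs_im_le : |z.im| ≤ 4 * R * s := large.le.trans (by nlinarith)
    calc 400 * K * s = 400 * (K * s * |z.im| / |z.im|) := by field_simp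
      _ ≤ 400 * (K * s * (4 * R * s) / |z.im|) := by gcongr
      _ = 1600 * R * (K * s ^ 2 / |z.im|) := by ring
      _ ≤ 1200000 * R * (max K (K ^ 2) * s ^ 2 / |z.im|) := by
        gcongr
        · norm_num
        · exact le_max_left _ _

lemma measure_iUnion_nearEigenvalueColumns_le (hμ : μ ≤ ENNReal.ofReal K • volume)
    (A : Matrix m m ℝ) {τ R : ℝ} (hτ : 0 < τ) (hτR : τ ≤ R) {z : ℂ} (hz : ‖z‖ ≤ 3 * R)
    (hz_im : z.im ≠ 0) {ε : ℝ} (hε : 0 < ε) :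
    (Measure.pi fun _ : m => Measure.pi fun _ : m => μ) (⋃ i, nearEigenvalueColumns A τ z R ε i)
      ≤ ENNReal.ofReal
          (1200000 * R * (max K (K ^ 2) * Fintype.card m ^ 2 * ε ^ 2 / (τ ^ 2 * |z.im|))) := by
  set t : ℝ := 1200000 * R * (max K (K ^ 2) * (ε * √(Fintype.card m) / τ) ^ 2 / |z.im|) with t_def
  have measure_le (i : m) : (Measure.pi fun _ : m => Measure.pi fun _ : m => μ)
      (nearEigenvalueColumns A τ z R ε i) ≤ ENNReal.ofReal t := by
    have : Nonempty m := ⟨i⟩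
    have : (0 : ℝ) < Fintype.card m := Nat.cast_pos.mpr Fintype.card_pos
    have slice_le (X : m → m → ℝ) := measure_slice_nearEigenvalueColumns_le hμ A hτ hτR hz hz_im
      (s := ε * √(Fintype.card m) / τ) (by positivity) (div_mul_cancel₀ _ hτ.ne').symm i X
    simpa using measure_pi_le_mul_of_update_le (fun _ : m => Measure.pi fun _ : m => μ) i
      (isClosed_nearEigenvalueColumns A τ z R ε i).measurableSet MeasurableSet.univ
      (ENNReal.ofReal t) (by simpa using slice_le)
  calc _ ≤ ∑ i, (Measure.pi fun _ : m => Measure.pi fun _ : m => μ)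
          (nearEigenvalueColumns A τ z R ε i) := measure_iUnion_fintype_le _ _
    _ ≤ ∑ _i : m, ENNReal.ofReal t := Finset.sum_le_sum fun i _ => measure_le i
    _ = ENNReal.ofReal (Fintype.card m * t) := by
        rw [Finset.sum_const, Finset.card_univ, nsmul_eq_mul,
          ENNReal.ofReal_mul (Nat.cast_nonneg _), ENNReal.ofReal_natCast]
    _ = _ := by
        rw [t_def, div_pow, mul_pow, Real.sq_sqrt (Nat.cast_nonneg _)]
        congr 1
        field_simp

end NearEigenvalueProbability

section RandomMatrix

lemma map_columns_eq_pi_of_iIndepFun {Ω E ι κ : Type*} [MeasurableSpace Ω] [MeasurableSpace E]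
    [Fintype ι] [Fintype κ] {P : Measure Ω} [IsProbabilityMeasure P] {Y : ι × κ → Ω → E}
    {μ : Measure E} [IsProbabilityMeasure μ] (indep : iIndepFun Y P)
    (aemeasurable : ∀ p, AEMeasurable (Y p) P) (law : ∀ p, P.map (Y p) = μ) :
    P.map (fun ω k j => Y (j, k) ω) = Measure.pi fun _ : κ => Measure.pi fun _ : ι => μ := by
  have joint_aemeasurable : AEMeasurable (fun ω (p : κ × ι) => Y p.swap ω) P :=
    aemeasurable_pi_lambda _ fun p => aemeasurable p.swap
  have joint_law : P.map (fun ω (p : κ × ι) => Y p.swap ω) = Measure.infinitePi fun _ => μ := by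
    rw [(iIndepFun_iff_map_fun_eq_infinitePi_map₀ joint_aemeasurable).mp
      (indep.precomp Prod.swap_injective)]
    simp only [law]
  calc P.map (fun ω k j => Y (j, k) ω)
      = (P.map fun ω (p : κ × ι) => Y p.swap ω).map (MeasurableEquiv.curry κ ι E) :=
        (AEMeasurable.map_map_of_aemeasurable
          (MeasurableEquiv.curry κ ι E).measurable.aemeasurable joint_aemeasurable).symm
    _ = Measure.pi fun _ : κ => Measure.pi fun _ : ι => μ := by
        rw [joint_law, Measure.infinitePi_map_curry fun _ _ => μ]
        simp only [Measure.infinitePi_eq_pi]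

variable {Ω Ω' : Type*} [MeasurableSpace Ω] [MeasurableSpace Ω'] {P : Measure Ω} {P' : Measure Ω'}
  {ξ : Ω' → ℝ} {K : ℝ}

lemma HasDensityBoundedBy.map_le_ofReal_smul_volume (hξ : HasDensityBoundedBy ξ P' K) :
    P'.map ξ ≤ ENNReal.ofReal K • volume := by
  obtain ⟨-, f, -, f_bounds, map_eq⟩ := hξ
  rw [map_eq, ← withDensity_const]
  exact withDensity_mono (ae_of_all _ fun x => ENNReal.ofReal_le_ofReal (f_bounds x).2)

variable {n : ℕ}

lemma mem_iUnion_nearEigenvalueColumns (hn : 1 ≤ n) {A G : Matrix (Fin n) (Fin n) ℝ}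
    {S δ K' ε : ℝ} {z : ℂ} (hS : ‖A‖ ≤ S) (hδ : 0 ≤ δ) (hG : ‖G‖ ≤ K')
    (hε : leastSingularValue (complexShift (A + δ • G) z) ≤ ε) :
    (fun k j => √(n : ℝ) * G j k)
      ∈ ⋃ i, nearEigenvalueColumns A (δ / √(n : ℝ)) z (S + δ * K') ε i := by
  have sqrt_pos : 0 < √(n : ℝ) := Real.sqrt_pos.mpr (Nat.cast_pos.mpr hn)
  have columns_eq :
      A + (δ / √(n : ℝ)) • (Matrix.of fun k j => √(n : ℝ) * G j k).transpose = A + δ • G := by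
    ext j k
    simp [← mul_assoc, div_mul_cancel₀ _ sqrt_pos.ne']
  obtain ⟨i, hi⟩ := exists_mem_nearKernel_of_leastSingularValue_le hn hε
  refine Set.mem_iUnion.mpr ⟨i, ?_, by rwa [columns_eq]⟩
  calc _ = ‖A + δ • G‖ := by rw [columns_eq]
    _ ≤ ‖A‖ + δ * ‖G‖ := by simpa [norm_smul, abs_of_nonneg hδ] using norm_add_le A (δ • G)
    _ ≤ S + δ * K' := by gcongr

variable [IsProbabilityMeasure P] [IsProbabilityMeasure P']

lemma IsScaledIIDMatrix.map_columns_eq_pi {G : Ω → Matrix (Fin n) (Fin n) ℝ}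
    (hG : IsScaledIIDMatrix G P ξ P') (hξ : AEMeasurable ξ P') :
    P.map (fun ω k j => √(n : ℝ) * G ω j k)
      = Measure.pi fun _ => Measure.pi fun _ => P'.map ξ :=
  have := Measure.isProbabilityMeasure_map hξ
  map_columns_eq_pi_of_iIndepFun hG.indep (fun p => (hG.copies p.1 p.2).aemeasurable_fst)
    fun p => (hG.copies p.1 p.2).map_eq

lemma IsScaledIIDMatrix.measureReal_leastSingularValue_le_of_pos {G : Ω → Matrix (Fin n) (Fin n) ℝ}
    (hG : IsScaledIIDMatrix G P ξ P') (hξ : HasDensityBoundedBy ξ P' K) (hn : 1 ≤ n)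
    {A : Matrix (Fin n) (Fin n) ℝ} {S δ K' ε : ℝ} {z : ℂ} (hS : ‖A‖ ≤ S) (hδ : 0 < δ)
    (hδS : δ ≤ S * √n) (hK' : 0 ≤ K') (hz : ‖z‖ ≤ 3 * (S + δ * K')) (hz_im : z.im ≠ 0)
    (hε : 0 < ε) :
    P.real {ω | ‖G ω‖ ≤ K' ∧ leastSingularValue (complexShift (A + δ • G ω) z) ≤ ε}
      ≤ 1200000 * (S + δ * K') * (max K (K ^ 2) * n ^ 3 * ε ^ 2 / (δ ^ 2 * |z.im|)) := by
  have sqrt_pos : 0 < √(n : ℝ) := Real.sqrt_pos.mpr (Nat.cast_pos.mpr hn)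
  have columns_aemeasurable : AEMeasurable (fun ω k j => √(n : ℝ) * G ω j k) P :=
    aemeasurable_pi_lambda _ fun k => aemeasurable_pi_lambda _ fun j => (hG.copies j k).1
  have : IsProbabilityMeasure (P'.map ξ) := Measure.isProbabilityMeasure_map hξ.1
  have scale_le : δ / √(n : ℝ) ≤ S + δ * K' :=
    ((div_le_iff₀ sqrt_pos).mpr hδS).trans (le_add_of_nonneg_right (by positivity))
  have R_nonneg : 0 ≤ S + δ * K' := le_trans (by positivity) scale_le
  refine ENNReal.toReal_le_of_le_ofReal (by positivity) ?_
  calc _ ≤ P ((fun ω k j => √(n : ℝ) * G ω j k) ⁻¹'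
          ⋃ i, nearEigenvalueColumns A (δ / √(n : ℝ)) z (S + δ * K') ε i) :=
        measure_mono fun ω hω => mem_iUnion_nearEigenvalueColumns hn hS hδ.le hω.1 hω.2
    _ ≤ P.map (fun ω k j => √(n : ℝ) * G ω j k)
          (⋃ i, nearEigenvalueColumns A (δ / √(n : ℝ)) z (S + δ * K') ε i) :=
        Measure.le_map_apply columns_aemeasurable _
    _ ≤ ENNReal.ofReal (1200000 * (S + δ * K') * (max K (K ^ 2) * Fintype.card (Fin n) ^ 2 *
          ε ^ 2 / ((δ / √(n : ℝ)) ^ 2 * |z.im|))) := by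
        rw [hG.map_columns_eq_pi hξ.1]
        exact measure_iUnion_nearEigenvalueColumns_le hξ.map_le_ofReal_smul_volume A
          (div_pos hδ sqrt_pos) scale_le hz hz_im hε
    _ = _ := by
        rw [Fintype.card_fin, div_pow, Real.sq_sqrt (Nat.cast_nonneg _)]
        congr 1
        field_simp

end RandomMatrix

theorem mainTheorem5_general {Ω Ω' : Type*} [MeasurableSpace Ω] [MeasurableSpace Ω']
    {P : Measure Ω} {P' : Measure Ω'} [IsProbabilityMeasure P] [IsProbabilityMeasure P']
    {ξ : Ω' → ℝ} {K : ℝ} (hξ : HasDensityBoundedBy ξ P' K) {n : ℕ} (hn : 1 ≤ n)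
    {G : Ω → Matrix (Fin n) (Fin n) ℝ} (hG : IsScaledIIDMatrix G P ξ P')
    {A : Matrix (Fin n) (Fin n) ℝ} {S : ℝ} (hS : ‖A‖ ≤ S) {δ : ℝ} (hδ : 0 < δ)
    (hδS : δ ≤ S * √n) {K' : ℝ} {z : ℂ} (hz : ‖z‖ ≤ 3 * (S + δ * K')) (hz_im : z.im ≠ 0) (ε : ℝ) :
    P.real {ω | ‖G ω‖ ≤ K' ∧
        leastSingularValue
          ((A + δ • G ω).map (fun x : ℝ => (x : ℂ)) - z • (1 : Matrix (Fin n) (Fin n) ℂ)) ≤ ε}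
      ≤ 1200000 * (S + δ * K') * (max K (K ^ 2) * n ^ 3 * ε ^ 2 / (δ ^ 2 * |z.im|)) := by
  obtain empty | ⟨ω, norm_le, singularValue_le⟩ := Set.eq_empty_or_nonempty {ω | ‖G ω‖ ≤ K' ∧
      leastSingularValue (complexShift (A + δ • G ω) z) ≤ ε}
  · have R_nonneg : 0 ≤ S + δ * K' := by linarith [norm_nonneg z]
    have : 0 ≤ max K (K ^ 2) := le_max_of_le_right (sq_nonneg K)
    refine (congrArg P.real empty).trans_le (measureReal_empty.trans_le ?_)
    positivity
  · have K'_nonneg : 0 ≤ K' := (norm_nonneg _).trans norm_le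
    have ε_nonneg : 0 ≤ ε := (LinearMap.singularValues_nonneg _ _).trans singularValue_le
    have continuous_bound : Continuous fun e : ℝ =>
        1200000 * (S + δ * K') * (max K (K ^ 2) * n ^ 3 * e ^ 2 / (δ ^ 2 * |z.im|)) := by fun_prop
    refine ge_of_tendsto (continuous_bound.continuousWithinAt (s := Set.Ioi ε)) ?_
    filter_upwards [self_mem_nhdsWithin] with e he
    refine le_trans ?_ (hG.measureReal_leastSingularValue_le_of_pos hξ hn hS hδ hδS K'_nonneg hz
      hz_im (ε_nonneg.trans_lt he))
    exact measureReal_mono fun ω h => ⟨h.1, h.2.trans (le_of_lt he)⟩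

theorem mainTheorem5 :
    ∃ c : ℝ, 0 < c ∧
      ∀ (Ω Ω' : Type*) [MeasurableSpace Ω] [MeasurableSpace Ω']
        (P : Measure Ω) (P' : Measure Ω') [IsProbabilityMeasure P] [IsProbabilityMeasure P']
        (ξ : Ω' → ℝ) (K : ℝ), IsSubGaussian ξ P' → HasDensityBoundedBy ξ P' K →
      ∀ (n : ℕ), 1 ≤ n →
      ∀ (G : Ω → Matrix (Fin n) (Fin n) ℝ), IsScaledIIDMatrix G P ξ P' →
      ∀ (A : Matrix (Fin n) (Fin n) ℝ), ‖A‖ ≤ 1 →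
      ∀ (δ : ℝ), 0 < δ → δ < 1 →
      ∀ (K' : ℝ) (z : ℂ), ‖z‖ ≤ 3 * δ * K' + 3 → z.im ≠ 0 →
      ∀ (ε : ℝ),
        P.real {ω | ‖G ω‖ ≤ K' ∧
            leastSingularValue
              ((A + δ • G ω).map (fun x : ℝ => (x : ℂ)) - z • (1 : Matrix (Fin n) (Fin n) ℂ)) ≤ ε}
          ≤ c * (1 + δ * K') * (max K (K ^ 2) * (n : ℝ) ^ 3 * ε ^ 2 / (δ ^ 2 * |z.im|)) := by
  refine ⟨1200000, by norm_num, ?_⟩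
  intro Ω Ω' _ _ P P' _ _ ξ K _ hξ n hn G hG A hA δ hδ hδ_lt K' z hz hz_im
  have one_le_sqrt : 1 ≤ 1 * √(n : ℝ) := by simpa using hn
  exact mainTheorem5_general hξ hn hG hA hδ (hδ_lt.le.trans one_le_sqrt) (by linarith) hz_im
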